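/- Let $H$ be a finite multigraph without loops (parallel edges are allowed), let $\delta(H)$ be its minimum degree, where the degree of a vertex is the number of edges incident with it, and let $G$ be the line graph of $H$: the simple graph whose vertices are the edges of $H$, two distinct edges being adjacent if and only if they have at least one common end. Let $\omega(G)$ and $\Delta(G)$ denote the clique number and the maximum degree of $G$, and let $\chi_l(G)$ denote its list chromatic number, i.e. the least $k$ such that for every assignment of sets $L(v)\subset\mathbb{N}$ with $|L(v)|=k$ to the vertices $v$ of $G$ there is a proper coloring $c$ of $G$ with $c(v)\in L(v)$ for all $v$. \textbf{Theorem.} If $\delta(H)\ge 7$, then $$\chi_l(G)\le\max\{\omega(G),\,\Delta(G)-1\}.$$ The hypothesis $\delta(H)\ge 7$ cannot be weakened to $\delta(H)\ge 6$: if $H$ is the $5$-cycle with each edge replaced by three parallel edges, then $\delta(H)=6$ and its line graph $G$ satisfies $\chi_l(G)>\max\{\omega(G),\,\Delta(G)-1\}$. -/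

import Mathlib

open scoped Graph

namespace SimpleGraph

variable {W : Type*}

/-- A list assignment `L` is good if `G` has a proper coloring `c` with `c v ∈ L v` for all `v`. -/
def IsGoodListAssignment (G : SimpleGraph W) (L : W → Finset ℕ) : Prop :=
  ∃ c : W → ℕ, (∀ v, c v ∈ L v) ∧ ∀ v w, G.Adj v w → c v ≠ c w

/-- `G` is `f`-choosable if every list assignment whose list at each `v` has exactly `f v` colors
is good. -/
def IsChoosable (G : SimpleGraph W) (f : W → ℕ) : Prop :=
  ∀ L : W → Finset ℕ, (∀ v, (L v).card = f v) → G.IsGoodListAssignment L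

/-- The list chromatic number: the least `k` such that `G` is `k`-choosable
(`⊤` if there is none). -/
noncomputable def listChromaticNumber (G : SimpleGraph W) : ℕ∞ :=
  ⨅ k ∈ {k : ℕ | G.IsChoosable fun _ => k}, (k : ℕ∞)

end SimpleGraph

namespace Graph

variable {α β : Type*}

/-- The degree of a vertex of a multigraph: the number of incident edges, loops counted twice. -/
noncomputable def degree (H : Graph α β) (x : α) : ℕ∞ :=
  (H.incidenceSet x).encard + (H.loopSet x).encard

/-- The minimum degree of a multigraph (`⊤` if it has no vertices). -/
noncomputable def minDegree (H : Graph α β) : ℕ∞ :=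
  ⨅ x ∈ V(H), H.degree x

/-- The line graph of a multigraph: a simple graph whose vertices are the edges of `H`, two
distinct edges being adjacent if they have a common end. -/
def lineGraph (H : Graph α β) : SimpleGraph E(H) where
  Adj e f := e ≠ f ∧ ∃ x, H.Inc e x ∧ H.Inc f x
  symm := ⟨fun _ _ h => ⟨h.1.symm, h.2.imp fun _ hx => hx.symm⟩⟩

/-- The 5-cycle with all edges tripled: for each `i` modulo 5, the three edges `(i, 0)`, `(i, 1)`,
`(i, 2)` join `i` to `i + 1`. -/
def tripledFiveCycle : Graph (Fin 5) (Fin 5 × Fin 3) where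
  vertexSet := Set.univ
  edgeSet := Set.univ
  IsLink e x y := s(x, y) = s(e.1, e.1 + 1)
  isLink_symm _ _ := ⟨fun _ _ h => Sym2.eq_swap.trans h⟩
  eq_or_eq_of_isLink_of_isLink := by
    intro e x y v w h h'
    have h2 := h.trans h'.symm
    rw [Sym2.eq_iff] at h2
    tauto
  edge_mem_iff_exists_isLink e := ⟨fun _ => ⟨e.1, e.1 + 1, rfl⟩, fun _ => trivial⟩
  left_mem_of_isLink _ _ _ _ := trivial

instance : Fintype E(tripledFiveCycle) :=
  inferInstanceAs (Fintype (Set.univ : Set (Fin 5 × Fin 3)))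

instance : DecidableRel tripledFiveCycle.lineGraph.Adj := fun e f =>
  inferInstanceAs (Decidable (e ≠ f ∧ ∃ x : Fin 5, (∃ y, s(x, y) = s(e.1.1, e.1.1 + 1)) ∧
    ∃ y, s(x, y) = s(f.1.1, f.1.1 + 1)))

end Graph

/-! Let k be the claimed bound, and take an edge set F minimal among those not colorable from given
lists of size k. If S ⊆ F is nonempty, then F \ S can be colored. Removing the colors this uses from
the lists on S leaves each e in S at least k - `ldeg s F e` + `ldeg s S e` colors, and S is not
colorable from what is left. `IsCritical` records this together with the clique bound and the degree
bounds, and `IsCritical.eq_empty` shows that F must be empty.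

The target S is a bipartite subgraph given by a maximum cut. By Galvin's kernel method and
`exists_proper_card_beats_lt`, a bipartite multigraph is colorable when each edge has as many colors
as the larger degree of its two ends. It therefore suffices that both ends of each edge e of S have
degree at least `ldeg s F e` - k + m + 1 in S, where m is the multiplicity of e. Here `ldeg s F e` -
k is 0 or 1, and the ends of e have degree at least 6 or 7 in F respectively. Keeping half of the
degrees is enough when m ≤ 2.

The rest of the work concerns larger multiplicities. Four parallel edges are impossible
(`mult_le_three`): the clique bound supplies nonadjacent pairs around them, and Hall's theorem
colors the resulting small configuration (`pairsColorable`). Two triples never share a vertex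
(`false_of_triples`), by explicit Galvin preferences on a local bipartite subgraph. Hence a cut
giving edges of triples slightly less weight keeps strictly more than half of the degree at the ends
of each triple it cuts, which is enough for m = 3 once `ldeg_le_of_vdeg_le_seven` excludes ends of
degree 7 with `ldeg s F e` = k + 1.

For the tripled 5-cycle, each color class has at most two of the fifteen edges, so eight colors are
needed, while the bound is at most seven. -/

namespace LineChoosability
-- Galvin's kernel method for bipartite multigraphs
section Bipartite
open scoped Classical
open Finset

variable {A B E : Type*}

/-- In a bipartite multigraph with an edge `e` joining `l e` to `r e`, prefer large values of `c` on
the left and small values on the right. `Beats l r c f e`: the edge `f` is preferred to `e` at a common end. -/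
def Beats (l : E → A) (r : E → B) (c : E → ℕ) (f e : E) : Prop :=
  l f = l e ∧ c e < c f ∨ r f = r e ∧ c f < c e

/-- `c` is a proper edge coloring of `S`. -/
def ProperOn (S : Finset E) (l : E → A) (r : E → B) (c : E → ℕ) : Prop :=
  ∀ e ∈ S, ∀ f ∈ S, e ≠ f → l e = l f ∨ r e = r f → c e ≠ c f

/-- This is stable matching. If the favorite edges of the left vertices form a matching, they are
the kernel. Otherwise two favorites share a right end, and the one less preferred there can be
deleted: whatever defeats the other favorite must do so at that right end, and so defeats the
deleted edge too. -/
theorem exists_kernel (l : E → A) (r : E → B) (c : E → ℕ) (S : Finset E)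
    (hc : ProperOn S l r c) :
    ∃ M ⊆ S, (∀ e ∈ M, ∀ f ∈ M, e ≠ f → l e ≠ l f ∧ r e ≠ r f) ∧
      ∀ e ∈ S, e ∉ M → ∃ f ∈ M, Beats l r c f e := by
  induction S using Finset.strongInduction with
  | H S ih =>
    set T := S.filter fun e => ∀ f ∈ S, l f = l e → c f ≤ c e with hT
    by_cases hmatch : ∀ e ∈ T, ∀ f ∈ T, r e = r f → e = f
    · refine ⟨T, filter_subset _ _, fun e he f hf hef => ⟨fun h => ?_, fun h =>
        hef (hmatch e he f hf h)⟩, fun e he heT => ?_⟩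
      · have he' := mem_filter.1 he
        have hf' := mem_filter.1 hf
        exact hc e he'.1 f hf'.1 hef (Or.inl h)
          (le_antisymm (hf'.2 e he'.1 h) (he'.2 f hf'.1 h.symm))
      · obtain ⟨f, hf, hmax⟩ := (S.filter fun f => l f = l e).exists_max_image c
          ⟨e, mem_filter.2 ⟨he, rfl⟩⟩
        have hf' := mem_filter.1 hf
        have hfT : f ∈ T := mem_filter.2 ⟨hf'.1, fun g hg hgf =>
          hmax g (mem_filter.2 ⟨hg, hgf.trans hf'.2⟩)⟩
        have hne : e ≠ f := fun h => heT (h ▸ hfT)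
        exact ⟨f, hfT, Or.inl ⟨hf'.2, lt_of_le_of_ne (hmax e (mem_filter.2 ⟨he, rfl⟩))
          (hc e he f hf'.1 hne (Or.inl hf'.2.symm))⟩⟩
    · push Not at hmatch
      obtain ⟨e, he, f, hf, hr, hne⟩ := hmatch
      have key : ∀ e ∈ T, ∀ f ∈ T, r e = r f → c e < c f → ∃ M ⊆ S,
          (∀ e ∈ M, ∀ f ∈ M, e ≠ f → l e ≠ l f ∧ r e ≠ r f) ∧
          ∀ e ∈ S, e ∉ M → ∃ f ∈ M, Beats l r c f e := by
        intro e he f hf hr hlt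
        have he' := mem_filter.1 he
        have hf' := mem_filter.1 hf
        obtain ⟨M, hMS, hM, hdom⟩ := ih (S.erase f) (erase_ssubset hf'.1)
          fun a ha b hb => hc a (mem_of_mem_erase ha) b (mem_of_mem_erase hb)
        refine ⟨M, hMS.trans (erase_subset _ _), hM, fun a ha haM => ?_⟩
        by_cases haf : a = f
        · subst haf
          by_cases heM : e ∈ M
          · exact ⟨e, heM, Or.inr ⟨hr, hlt⟩⟩
          · have hea : e ≠ a := fun h => by rw [h] at hlt; exact lt_irrefl _ hlt
            obtain ⟨g, hg, hb⟩ := hdom e (mem_erase.2 ⟨hea, he'.1⟩) heM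
            rcases hb with ⟨h1, h2⟩ | ⟨h1, h2⟩
            · exact absurd (he'.2 g (mem_of_mem_erase (hMS hg)) h1) (not_le.2 h2)
            · exact ⟨g, hg, Or.inr ⟨h1.trans hr, h2.trans hlt⟩⟩
        · exact hdom a (mem_erase.2 ⟨haf, ha⟩) haM
      rcases lt_or_gt_of_ne (hc e (mem_filter.1 he).1 f (mem_filter.1 hf).1 hne (Or.inr hr))
        with h | h
      · exact key e he f hf hr h
      · exact key f hf e he hr.symm h

/-- Galvin's kernel argument. -/
theorem exists_coloring_of_card_beats_lt (l : E → A) (r : E → B) (c : E → ℕ) (S : Finset E)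
    (hc : ProperOn S l r c) (L : E → Finset ℕ)
    (hL : ∀ e ∈ S, #{f ∈ S | Beats l r c f e} < #(L e)) :
    ∃ φ : E → ℕ, (∀ e ∈ S, φ e ∈ L e) ∧ ProperOn S l r φ := by
  induction S using Finset.strongInduction generalizing L with
  | H S ih =>
    rcases S.eq_empty_or_nonempty with rfl | ⟨e₀, he₀⟩
    · exact ⟨fun _ => 0, by simp, by simp [ProperOn]⟩
    obtain ⟨a, ha⟩ : (L e₀).Nonempty := card_pos.1 (pos_of_gt (hL e₀ he₀))
    -- The kernel gets color a. Every other edge with a in its list loses this color but also loses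
    -- a preferred edge, so the strict inequality survives.
    obtain ⟨M, hMT, hM, hdom⟩ := exists_kernel l r c (S.filter fun e => a ∈ L e)
      fun e he f hf => hc e (mem_filter.1 he).1 f (mem_filter.1 hf).1
    have hMS : M ⊆ S := hMT.trans (filter_subset _ _)
    have hMne : M.Nonempty := by
      by_contra h
      rw [not_nonempty_iff_eq_empty] at h
      obtain ⟨f, hf, -⟩ := hdom e₀ (mem_filter.2 ⟨he₀, ha⟩) (by simp [h])
      simp [h] at hf
    obtain ⟨φ, hφL, hφ⟩ := ih (S \ M) (sdiff_ssubset hMS hMne)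
      (fun e he f hf => hc e (mem_sdiff.1 he).1 f (mem_sdiff.1 hf).1)
      (fun e => (L e).erase a) (fun e he => by
        obtain ⟨heS, heM⟩ := mem_sdiff.1 he
        have hsub : {f ∈ S \ M | Beats l r c f e} ⊆ {f ∈ S | Beats l r c f e} :=
          filter_subset_filter _ sdiff_subset
        by_cases haL : a ∈ L e
        · obtain ⟨f, hf, hfe⟩ := hdom e (mem_filter.2 ⟨heS, haL⟩) heM
          have : #{f ∈ S \ M | Beats l r c f e} < #{f ∈ S | Beats l r c f e} :=
            card_lt_card ((ssubset_iff_of_subset hsub).2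
              ⟨f, mem_filter.2 ⟨hMS hf, hfe⟩, by simp [hf]⟩)
          have h2 := card_erase_of_mem haL
          have h3 := hL e heS
          omega
        · rw [erase_eq_of_notMem haL]
          exact (card_le_card hsub).trans_lt (hL e heS))
    refine ⟨fun e => if e ∈ M then a else φ e, fun e he => ?_, fun e he f hf hef hadj => ?_⟩
    · by_cases heM : e ∈ M
      · simpa [heM] using (mem_filter.1 (hMT heM)).2
      · simpa [heM] using mem_of_mem_erase (hφL e (mem_sdiff.2 ⟨he, heM⟩))
    · by_cases heM : e ∈ M <;> by_cases hfM : f ∈ M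
      · have := hM e heM f hfM hef
        tauto
      · have := ne_of_mem_erase (hφL f (mem_sdiff.2 ⟨hf, hfM⟩))
        simpa [heM, hfM] using this.symm
      · have := ne_of_mem_erase (hφL e (mem_sdiff.2 ⟨he, heM⟩))
        simpa [heM, hfM] using this
      · simpa [heM, hfM] using
          hφ e (mem_sdiff.2 ⟨he, heM⟩) f (mem_sdiff.2 ⟨hf, hfM⟩) hef hadj

theorem hall_on [Nonempty A] [DecidableEq A] (C : Finset B) (t : B → Finset A)
    (h : ∀ C' ⊆ C, #C' ≤ #(C'.biUnion t)) :
    ∃ g : B → A, Set.InjOn g C ∧ ∀ b ∈ C, g b ∈ t b := by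
  obtain ⟨g, hg, hgt⟩ := (all_card_le_biUnion_card_iff_exists_injective
    fun b : C => t b).1 fun s => by
      have := h (s.map (Function.Embedding.subtype _)) (fun b hb => by
        obtain ⟨⟨x, hx⟩, _, rfl⟩ := mem_map.1 hb
        exact hx)
      rw [card_map] at this
      refine this.trans (card_le_card fun a ha => ?_)
      simp only [mem_biUnion, mem_map] at ha ⊢
      obtain ⟨_, ⟨x, hx, rfl⟩, hax⟩ := ha
      exact ⟨x, hx, hax⟩
  refine ⟨fun b => if hb : b ∈ C then g ⟨b, hb⟩ else Classical.arbitrary A, ?_, fun b hb => ?_⟩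
  · intro b hb b' hb' hbb
    simp only [mem_coe] at hb hb'
    simp only [hb, hb', dif_pos] at hbb
    simpa using hg hbb
  · simpa [hb] using hgt ⟨b, hb⟩

/-- Join each right vertex only to neighbors of at least its own degree, and take a minimal nonempty
set C of right vertices with at most #C such neighbors. If it has none, one edge at C suffices.
Otherwise minimality gives Hall's condition, and the matching covers all these neighbors. -/
theorem exists_peelable_matching (l : E → A) (r : E → B) (S : Finset E) (hS : S.Nonempty) :
    ∃ M ⊆ S, M.Nonempty ∧ Set.InjOn l M ∧ Set.InjOn r M ∧
      ∀ e ∈ S, (∃ f ∈ M, r f = r e) → (∃ f ∈ M, l f = l e) ∨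
        #{f ∈ S | l f = l e} < #{f ∈ S | r f = r e} := by
  obtain ⟨e₀, he₀⟩ := hS
  have : Nonempty A := ⟨l e₀⟩
  set dA : A → ℕ := fun a => #{f ∈ S | l f = a} with hdA
  set dB : B → ℕ := fun b => #{f ∈ S | r f = b} with hdB
  set t : B → Finset A := fun b => {e ∈ S | r e = b ∧ dB b ≤ dA (l e)}.image l with ht
  -- Otherwise a matching sends the right vertices injectively to left vertices of no smaller degree
  -- and misses some left vertex of positive degree. But both degree sums equal #S.
  have hex : ∃ C, C ⊆ S.image r ∧ C.Nonempty ∧ #(C.biUnion t) ≤ #C := by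
    by_contra hcon
    push Not at hcon
    obtain ⟨g, hg, hgt⟩ := hall_on (S.image r) t fun C' hC' => by
      rcases C'.eq_empty_or_nonempty with rfl | h
      · simp
      · exact (hcon C' hC' h).le
    have hlt := hcon (S.image r) Subset.rfl ⟨r e₀, mem_image_of_mem r he₀⟩
    rw [← card_image_of_injOn hg] at hlt
    obtain ⟨a, ha, hag⟩ := exists_mem_notMem_of_card_lt_card hlt
    have hSB : #S = ∑ b ∈ S.image r, dB b := card_eq_sum_card_image r S
    have hSA : #S = ∑ a ∈ S.image l, dA a := card_eq_sum_card_image l S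
    have h1 : ∑ b ∈ S.image r, dB b ≤ ∑ b ∈ S.image r, dA (g b) := sum_le_sum fun b hb => by
      obtain ⟨e, he, hle⟩ := mem_image.1 (hgt b hb)
      rw [← hle]
      exact (mem_filter.1 he).2.2
    have h2 : ∑ b ∈ S.image r, dA (g b) = ∑ a ∈ (S.image r).image g, dA a :=
      (sum_image hg).symm
    have hsub : insert a ((S.image r).image g) ⊆ S.image l := by
      intro x hx
      rcases mem_insert.1 hx with rfl | hx
      · obtain ⟨b, _, hb⟩ := mem_biUnion.1 ha
        obtain ⟨e, he, hle⟩ := mem_image.1 hb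
        exact mem_image.2 ⟨e, (mem_filter.1 he).1, hle⟩
      · obtain ⟨b, hb, rfl⟩ := mem_image.1 hx
        obtain ⟨e, he, hle⟩ := mem_image.1 (hgt b hb)
        exact mem_image.2 ⟨e, (mem_filter.1 he).1, hle⟩
    have h3 := sum_le_sum_of_subset (f := dA) hsub
    rw [sum_insert hag] at h3
    have h4 : 0 < dA a := by
      obtain ⟨e, he, hle⟩ := mem_image.1 (hsub (mem_insert_self _ _))
      exact card_pos.2 ⟨e, mem_filter.2 ⟨he, hle⟩⟩
    omega
  obtain ⟨C, hC⟩ : ∃ C, Minimal (fun C => C ⊆ S.image r ∧ C.Nonempty ∧ #(C.biUnion t) ≤ #C) C :=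
    exists_minimal_of_wellFoundedLT _ hex
  obtain ⟨hCS, hCne, hCcard⟩ := hC.prop
  rcases (C.biUnion t).eq_empty_or_nonempty with hN | hN
  · obtain ⟨b, hb⟩ := hCne
    obtain ⟨e, he, rfl⟩ := mem_image.1 (hCS hb)
    refine ⟨{e}, by simpa using he, by simp, by simp, by simp, fun f hf hfe => Or.inr ?_⟩
    obtain ⟨g, hg, hgf⟩ := hfe
    rw [mem_singleton] at hg
    subst hg
    by_contra hlt
    have : l f ∈ C.biUnion t := mem_biUnion.2 ⟨r g, hb, mem_image.2 ⟨f, mem_filter.2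
      ⟨hf, hgf.symm, by rw [hgf]; exact not_lt.1 hlt⟩, rfl⟩⟩
    simp [hN] at this
  · have hmin : ∀ C' ⊆ C, C'.Nonempty → C' ≠ C → #C' < #(C'.biUnion t) := by
      intro C' hC' hne hneq
      by_contra hle
      exact hneq (subset_antisymm hC' (hC.le_of_le ⟨hC'.trans hCS, hne, not_lt.1 hle⟩ hC'))
    obtain ⟨g, hg, hgt⟩ := hall_on C t fun C' hC' => by
      rcases C'.eq_empty_or_nonempty with rfl | hne
      · simp
      by_cases heq : C' = C
      · subst heq
        obtain ⟨b, hb⟩ := hne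
        rcases (C'.erase b).eq_empty_or_nonempty with h0 | h0
        · have h5 := card_erase_of_mem hb
          rw [h0, card_empty] at h5
          have := card_pos.2 hN
          omega
        · have h1 := hmin _ (erase_subset b C') h0 (fun h => by
            rw [← h] at hb; simp at hb)
          have h2 := card_le_card (biUnion_subset_biUnion_of_subset_left t (erase_subset b C'))
          have h3 := card_erase_of_mem hb
          omega
      · exact (hmin C' hC' hne heq).le
    have hrange : C.image g = C.biUnion t := by
      refine eq_of_subset_of_card_le (fun a ha => ?_) ?_
      · obtain ⟨b, hb, rfl⟩ := mem_image.1 ha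
        exact mem_biUnion.2 ⟨b, hb, hgt b hb⟩
      · rwa [card_image_of_injOn hg]
    have hedge : ∀ b, ∃ e, b ∈ C → e ∈ S ∧ r e = b ∧ l e = g b := by
      intro b
      by_cases hb : b ∈ C
      · obtain ⟨e, he, hle⟩ := mem_image.1 (hgt b hb)
        exact ⟨e, fun _ => ⟨(mem_filter.1 he).1, (mem_filter.1 he).2.1, hle⟩⟩
      · exact ⟨e₀, fun h => absurd h hb⟩
    choose m hm using hedge
    refine ⟨C.image m, ?_, hCne.image m, ?_, ?_, ?_⟩
    · intro e he
      obtain ⟨b, hb, rfl⟩ := mem_image.1 he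
      exact (hm b hb).1
    · intro e he f hf hef
      obtain ⟨b, hb, rfl⟩ := mem_image.1 (mem_coe.1 he)
      obtain ⟨b', hb', rfl⟩ := mem_image.1 (mem_coe.1 hf)
      rw [(hm b hb).2.2, (hm b' hb').2.2] at hef
      rw [hg hb hb' hef]
    · intro e he f hf hef
      obtain ⟨b, hb, rfl⟩ := mem_image.1 (mem_coe.1 he)
      obtain ⟨b', hb', rfl⟩ := mem_image.1 (mem_coe.1 hf)
      rw [(hm b hb).2.1, (hm b' hb').2.1] at hef
      rw [hef]
    · rintro e he ⟨f, hf, hfe⟩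
      obtain ⟨b, hb, rfl⟩ := mem_image.1 hf
      rw [(hm b hb).2.1] at hfe
      subst hfe
      by_cases hlt : dA (l e) < dB (r e)
      · exact Or.inr hlt
      · have : l e ∈ C.biUnion t := mem_biUnion.2 ⟨r e, hb, mem_image.2 ⟨e, mem_filter.2
          ⟨he, rfl, not_lt.1 hlt⟩, rfl⟩⟩
        rw [← hrange] at this
        obtain ⟨b', hb', hgb⟩ := mem_image.1 this
        exact Or.inl ⟨m b', mem_image_of_mem m hb', by rw [(hm b' hb').2.2, hgb]⟩

/-- A bipartite multigraph has preferences for which at most `max (d u) (d w) - 1` edges beat an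
edge `uw`. -/
theorem exists_proper_card_beats_lt (l : E → A) (r : E → B) (S : Finset E) :
    ∃ c : E → ℕ, ProperOn S l r c ∧ ∀ e ∈ S,
      #{f ∈ S | Beats l r c f e} < max #{f ∈ S | l f = l e} #{f ∈ S | r f = r e} := by
  induction S using Finset.strongInduction with
  | H S ih =>
    rcases S.eq_empty_or_nonempty with rfl | hS
    · exact ⟨fun _ => 0, by simp [ProperOn], by simp⟩
    obtain ⟨M, hMS, hMne, hMl, hMr, hM⟩ := exists_peelable_matching l r S hS
    obtain ⟨c, hc, hcard⟩ := ih (S \ M) (sdiff_ssubset hMS hMne)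
    -- The value 0 makes M least preferred on the left and most preferred on the right. Another edge
    -- gains at most one preferred edge, and only if its right end is covered; then the choice of M
    -- makes the larger of its two degrees drop after deletion.
    set c' : E → ℕ := fun e => if e ∈ M then 0 else c e + 1 with hc'
    have hc'M : ∀ e ∈ M, c' e = 0 := fun e he => by simp [hc', he]
    have hc'N : ∀ e, e ∉ M → c' e = c e + 1 := fun e he => by simp [hc', he]
    refine ⟨c', fun e he f hf hef hadj => ?_, fun e he => ?_⟩
    · by_cases heM : e ∈ M <;> by_cases hfM : f ∈ M
      · rcases hadj with h | h
        · exact absurd (hMl heM hfM h) hef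
        · exact absurd (hMr heM hfM h) hef
      · rw [hc'M e heM, hc'N f hfM]; omega
      · rw [hc'N e heM, hc'M f hfM]; omega
      · rw [hc'N e heM, hc'N f hfM]
        have := hc e (mem_sdiff.2 ⟨he, heM⟩) f (mem_sdiff.2 ⟨hf, hfM⟩) hef hadj
        omega
    · by_cases heM : e ∈ M
      · refine lt_max_of_lt_left (card_lt_card ((ssubset_iff_of_subset ?_).2
          ⟨e, by simp [he], fun h => by
            rcases (mem_filter.1 h).2 with h | h <;> exact lt_irrefl _ h.2⟩))
        intro f hf
        rw [mem_filter] at hf ⊢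
        refine ⟨hf.1, ?_⟩
        rcases hf.2 with h | h
        · exact h.1
        · rw [hc'M e heM] at h
          exact absurd h.2 (Nat.not_lt_zero _)
      · have hlt := hcard e (mem_sdiff.2 ⟨he, heM⟩)
        have hbl : ∀ f ∈ S, f ∉ M → (Beats l r c' f e ↔ Beats l r c f e) := by
          intro f _ hfM
          simp only [Beats, hc'N f hfM, hc'N e heM, add_lt_add_iff_right]
        have hsubl : {f ∈ S \ M | l f = l e} ⊆ {f ∈ S | l f = l e} :=
          filter_subset_filter _ sdiff_subset
        have hsubr : {f ∈ S \ M | r f = r e} ⊆ {f ∈ S | r f = r e} :=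
          filter_subset_filter _ sdiff_subset
        have hlel := card_le_card hsubl
        have hler := card_le_card hsubr
        by_cases hcov : ∃ g ∈ M, r g = r e
        · obtain ⟨g, hgM, hge⟩ := hcov
          have h1 : #{f ∈ S | Beats l r c' f e} ≤ #{f ∈ S \ M | Beats l r c f e} + 1 := by
            rw [← card_singleton g]
            refine (card_le_card fun f hf => ?_).trans (card_union_le _ _)
            rw [mem_filter] at hf
            by_cases hfM : f ∈ M
            · refine mem_union_right _ (mem_singleton.2 (hMr hfM hgM ?_))
              rcases hf.2 with h | h
              · rw [hc'M f hfM] at h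
                exact absurd h.2 (Nat.not_lt_zero _)
              · exact h.1.trans hge.symm
            · exact mem_union_left _ (mem_filter.2 ⟨mem_sdiff.2 ⟨hf.1, hfM⟩,
                (hbl f hf.1 hfM).1 hf.2⟩)
          have h2 : #{f ∈ S \ M | r f = r e} < #{f ∈ S | r f = r e} :=
            card_lt_card ((ssubset_iff_of_subset hsubr).2
              ⟨g, mem_filter.2 ⟨hMS hgM, hge⟩, by simp [hgM]⟩)
          rcases hM e he ⟨g, hgM, hge⟩ with ⟨g', hgM', hge'⟩ | h
          · have h3 : #{f ∈ S \ M | l f = l e} < #{f ∈ S | l f = l e} :=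
              card_lt_card ((ssubset_iff_of_subset hsubl).2
                ⟨g', mem_filter.2 ⟨hMS hgM', hge'⟩, by simp [hgM']⟩)
            omega
          · omega
        · have h1 : #{f ∈ S | Beats l r c' f e} ≤ #{f ∈ S \ M | Beats l r c f e} := by
            refine card_le_card fun f hf => ?_
            rw [mem_filter] at hf
            have hfM : f ∉ M := by
              intro hfM
              rcases hf.2 with h | h
              · rw [hc'M f hfM] at h
                exact absurd h.2 (Nat.not_lt_zero _)
              · exact hcov ⟨f, hfM, h.1⟩
            exact mem_filter.2 ⟨mem_sdiff.2 ⟨hf.1, hfM⟩, (hbl f hf.1 hfM).1 hf.2⟩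
          omega

end Bipartite

/-! ### Coloring a clique together with nonadjacent pairs -/

section Lists
open scoped Classical
open Finset

variable {E : Type*}

theorem exists_injOn_choice (K : Finset E) (M : E → Finset ℕ)
    (h : ∀ C ⊆ K, C.Nonempty → ∃ k ∈ C, #C ≤ #(M k)) :
    ∃ φ : E → ℕ, Set.InjOn φ K ∧ ∀ k ∈ K, φ k ∈ M k := by
  refine hall_on K M fun C hC => ?_
  rcases C.eq_empty_or_nonempty with rfl | hne
  · simp
  · obtain ⟨k, hk, hle⟩ := h C hC hne
    exact hle.trans (card_le_card (subset_biUnion_of_mem M hk))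

/-- Hall's condition: a subset containing z is served by z alone, one omitting z but not z' has at
most #K - 1 elements, and any other has at most #K - 2. -/
theorem exists_injOn_choice_of_two (K : Finset E) (M : E → Finset ℕ) {z z' : E} (hz : z ∈ K)
    (hz' : z' ∈ K) (hne : z ≠ z') (h : ∀ k ∈ K, #K ≤ #(M k) + 2) (h1 : #K ≤ #(M z') + 1)
    (h2 : #K ≤ #(M z)) : ∃ φ : E → ℕ, Set.InjOn φ K ∧ ∀ k ∈ K, φ k ∈ M k := by
  refine exists_injOn_choice K M fun C hC hCne => ?_
  by_cases hzC : z ∈ C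
  · exact ⟨z, hzC, (card_le_card hC).trans h2⟩
  have h3 : C ⊆ K.erase z := fun x hx => mem_erase.2 ⟨fun h => hzC (h ▸ hx), hC hx⟩
  have h4 := card_erase_of_mem hz
  by_cases hzC' : z' ∈ C
  · refine ⟨z', hzC', ?_⟩
    have := card_le_card h3
    omega
  · obtain ⟨k, hk⟩ := hCne
    refine ⟨k, hk, ?_⟩
    have h5 : C ⊆ (K.erase z).erase z' := fun x hx =>
      mem_erase.2 ⟨fun h => hzC' (h ▸ hx), h3 hx⟩
    have h6 := card_erase_of_mem (mem_erase.2 ⟨hne.symm, hz'⟩)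
    have h7 := card_le_card h5
    have h8 := h k (hC hk)
    omega

/-- Coloring a clique `K` together with two vertices that are nonadjacent to each other. -/
theorem exists_choice_pair (K : Finset E) (L : E → Finset ℕ) (A A' : Finset ℕ)
    (hL : ∀ k ∈ K, #K + 1 ≤ #(L k)) (hA : A.Nonempty) (hA' : A'.Nonempty)
    (h : #K + 2 ≤ #A + #A') :
    ∃ α ∈ A, ∃ α' ∈ A', ∃ φ : E → ℕ, Set.InjOn φ K ∧
      ∀ k ∈ K, φ k ∈ L k ∧ φ k ≠ α ∧ φ k ≠ α' := by
  have fin : ∀ α ∈ A, ∀ α' ∈ A', (∀ C ⊆ K, C.Nonempty → ∃ k ∈ C, #C ≤ #(L k \ {α, α'})) →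
      ∃ α ∈ A, ∃ α' ∈ A', ∃ φ : E → ℕ, Set.InjOn φ K ∧
      ∀ k ∈ K, φ k ∈ L k ∧ φ k ≠ α ∧ φ k ≠ α' := by
    intro α hα α' hα' hC
    obtain ⟨φ, hφ, hφL⟩ := exists_injOn_choice K _ hC
    exact ⟨α, hα, α', hα', φ, hφ, fun k hk => by simpa using hφL k hk⟩
  have hgen : ∀ k ∈ K, ∀ α α', #K ≤ #(L k \ {α, α'}) + 1 := by
    intro k hk α α'
    have h1 := le_card_sdiff {α, α'} (L k)
    have h2 := card_le_two (a := α) (b := α')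
    have h3 := hL k hk
    omega
  by_cases hc : ∃ c, c ∈ A ∧ c ∈ A'
  · obtain ⟨c, hcA, hcA'⟩ := hc
    refine fin c hcA c hcA' fun C hCK ⟨k, hk⟩ => ⟨k, hk, ?_⟩
    have h1 := le_card_sdiff {c, c} (L k)
    have h3 := hL k (hCK hk)
    have h4 := card_le_card hCK
    simp only [pair_eq_singleton, card_singleton] at h1 ⊢
    omega
  have hdisj : Disjoint A A' := disjoint_left.2 fun x hx hx' => hc ⟨x, hx, hx'⟩
  rcases K.eq_empty_or_nonempty with rfl | ⟨z, hz⟩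
  · obtain ⟨α, hα⟩ := hA
    obtain ⟨α', hα'⟩ := hA'
    exact ⟨α, hα, α', hα', fun _ => 0, by simp, by simp⟩
  -- One vertex z keeping #K colors is enough for Hall, since every other vertex keeps #K - 1. If
  -- the list of z is small, the disjoint union of A and A' contains a color outside it.
  obtain ⟨α, hα, α', hα', hza⟩ : ∃ α ∈ A, ∃ α' ∈ A', #K ≤ #(L z \ {α, α'}) := by
    by_cases hbig : #K + 2 ≤ #(L z)
    · obtain ⟨α, hα⟩ := hA
      obtain ⟨α', hα'⟩ := hA'
      refine ⟨α, hα, α', hα', ?_⟩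
      have h1 := le_card_sdiff {α, α'} (L z)
      have h2 := card_le_two (a := α) (b := α')
      omega
    · obtain ⟨p, hp, hpz⟩ := exists_mem_notMem_of_card_lt_card (s := L z) (t := A ∪ A') (by
        rw [card_union_of_disjoint hdisj]; omega)
      have h3 := hL z hz
      rcases mem_union.1 hp with hp | hp
      · obtain ⟨α', hα'⟩ := hA'
        refine ⟨p, hp, α', hα', ?_⟩
        rw [show L z \ {p, α'} = L z \ {α'} by
          ext x; simp only [mem_sdiff, mem_insert, mem_singleton]
          constructor
          · tauto
          · rintro ⟨h1, h2⟩
            exact ⟨h1, fun h => h.elim (fun h => hpz (h ▸ h1)) h2⟩]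
        have h1 := le_card_sdiff {α'} (L z)
        rw [card_singleton] at h1
        omega
      · obtain ⟨α, hα⟩ := hA
        refine ⟨α, hα, p, hp, ?_⟩
        rw [show L z \ {α, p} = L z \ {α} by
          ext x; simp only [mem_sdiff, mem_insert, mem_singleton]
          constructor
          · tauto
          · rintro ⟨h1, h2⟩
            exact ⟨h1, fun h => h.elim h2 (fun h => hpz (h ▸ h1))⟩]
        have h1 := le_card_sdiff {α} (L z)
        rw [card_singleton] at h1
        omega
  refine fin α hα α' hα' fun C hCK ⟨k, hk⟩ => ?_
  by_cases hzC : z ∈ C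
  · exact ⟨z, hzC, (card_le_card hCK).trans hza⟩
  · refine ⟨k, hk, ?_⟩
    have h3 : C ⊆ K.erase z := fun x hx => mem_erase.2 ⟨fun h => hzC (h ▸ hx), hCK hx⟩
    have h4 := card_erase_of_mem hz
    have h5 := card_le_card h3
    have h6 := hgen k (hCK hk) α α'
    have h7 := card_pos.2 ⟨z, hz⟩
    omega

/-- The clique `K` can be colored from `L` together with two pairs of vertices with lists
`A`, `A'` and `B`, `B'`, with equal colors allowed only within the pairs. -/
def PairsColorable (K : Finset E) (L : E → Finset ℕ) (A A' B B' : Finset ℕ) : Prop :=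
  ∃ α ∈ A, ∃ α' ∈ A', ∃ β ∈ B, ∃ β' ∈ B', α ≠ β ∧ α ≠ β' ∧ α' ≠ β ∧ α' ≠ β' ∧
    ∃ φ : E → ℕ, Set.InjOn φ K ∧
      ∀ k ∈ K, φ k ∈ L k ∧ φ k ≠ α ∧ φ k ≠ α' ∧ φ k ≠ β ∧ φ k ≠ β'

theorem PairsColorable.swap_left {K : Finset E} {L : E → Finset ℕ} {A A' B B' : Finset ℕ}
    (h : PairsColorable K L A A' B B') : PairsColorable K L A' A B B' := by
  obtain ⟨α, hα, α', hα', β, hβ, β', hβ', h1, h2, h3, h4, φ, hφ, hφL⟩ := h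
  exact ⟨α', hα', α, hα, β, hβ, β', hβ', h3, h4, h1, h2, φ, hφ, fun k hk => by
    have := hφL k hk; tauto⟩

theorem PairsColorable.swap {K : Finset E} {L : E → Finset ℕ} {A A' B B' : Finset ℕ}
    (h : PairsColorable K L A A' B B') : PairsColorable K L B B' A A' := by
  obtain ⟨α, hα, α', hα', β, hβ, β', hβ', h1, h2, h3, h4, φ, hφ, hφL⟩ := h
  exact ⟨β, hβ, β', hβ', α, hα, α', hα', h1.symm, h3.symm, h2.symm, h4.symm, φ, hφ, fun k hk => by
    have := hφL k hk; tauto⟩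

theorem PairsColorable.mono {K : Finset E} {L L' : E → Finset ℕ} {A A' B B' : Finset ℕ}
    (h : PairsColorable K L A A' B B') (hL : ∀ k ∈ K, L k ⊆ L' k) :
    PairsColorable K L' A A' B B' := by
  obtain ⟨α, hα, α', hα', β, hβ, β', hβ', h1, h2, h3, h4, φ, hφ, hφL⟩ := h
  exact ⟨α, hα, α', hα', β, hβ, β', hβ', h1, h2, h3, h4, φ, hφ, fun k hk =>
    ⟨hL k hk (hφL k hk).1, (hφL k hk).2⟩⟩

/-- The shared color goes on both members of the first pair, so every list loses at most one color
and the one-pair lemma applies. -/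
theorem PairsColorable.of_common {K : Finset E} {L : E → Finset ℕ} {A A' B B' : Finset ℕ}
    (hL : ∀ k ∈ K, #(L k) = #K + 2) (hB : 3 ≤ #B) (hB' : 3 ≤ #B') (h : #K + 4 ≤ #B + #B')
    {c : ℕ} (hcA : c ∈ A) (hcA' : c ∈ A') : PairsColorable K L A A' B B' := by
  have herase : ∀ X : Finset ℕ, #X ≤ #(X.erase c) + 1 := fun X => by
    have := pred_card_le_card_erase (s := X) (a := c); omega
  obtain ⟨β, hβ, β', hβ', φ, hφ, hφL⟩ := exists_choice_pair K (fun k => (L k).erase c)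
    (B.erase c) (B'.erase c) (fun k hk => by have := herase (L k); have := hL k hk; omega)
    (card_pos.1 (by have := herase B; omega)) (card_pos.1 (by have := herase B'; omega))
    (by have := herase B; have := herase B'; omega)
  rw [mem_erase] at hβ hβ'
  exact ⟨c, hcA, c, hcA', β, hβ.2, β', hβ'.2, hβ.1.symm, hβ'.1.symm, hβ.1.symm, hβ'.1.symm,
    φ, hφ, fun k hk => by have := hφL k hk; simp only [mem_erase] at this; tauto⟩

/-- The pairs remove at most four colors from a list of size #K + 2. Two of them cost z nothing and
one costs z' nothing, which is the situation of `exists_injOn_choice_of_two`. -/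
theorem PairsColorable.of_saved {K : Finset E} {L : E → Finset ℕ} {A A' B B' : Finset ℕ}
    (hL : ∀ k ∈ K, #(L k) = #K + 2) {α α' β β' : ℕ} (hα : α ∈ A) (hα' : α' ∈ A') (hβ : β ∈ B)
    (hβ' : β' ∈ B') (h1 : α ≠ β) (h2 : α ≠ β') (h3 : α' ≠ β) (h4 : α' ≠ β') {z z' : E}
    (hz : z ∈ K) (hz' : z' ∈ K) (hne : z ≠ z') {p q r : ℕ}
    (hp : p ∈ ({α, α', β, β'} : Finset ℕ)) (hq : q ∈ ({α, α', β, β'} : Finset ℕ))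
    (hr : r ∈ ({α, α', β, β'} : Finset ℕ)) (hpq : p ≠ q) (hpz : p ∉ L z) (hqz : q ∉ L z)
    (hrz : r ∉ L z') : PairsColorable K L A A' B B' := by
  set R : Finset ℕ := {α, α', β, β'} with hR
  have hR4 : #R ≤ 4 := card_le_four
  have hcard : ∀ X : Finset ℕ, #(X \ R) + #(X ∩ R) = #X := fun X => card_sdiff_add_card_inter X R
  obtain ⟨φ, hφ, hφL⟩ := exists_injOn_choice_of_two K (fun k => L k \ R) hz hz' hne
    (fun k hk => by
      have := hcard (L k); have := card_le_card (inter_subset_right : L k ∩ R ⊆ R)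
      have := hL k hk; omega)
    (by
      have h5 : L z' ∩ R ⊆ R.erase r := fun x hx => mem_erase.2
        ⟨fun h => hrz (h ▸ (mem_inter.1 hx).1), (mem_inter.1 hx).2⟩
      have := card_le_card h5; have := card_erase_of_mem hr; have := hcard (L z')
      have := hL z' hz'; omega)
    (by
      have h5 : L z ∩ R ⊆ (R.erase p).erase q := fun x hx => mem_erase.2
        ⟨fun h => hqz (h ▸ (mem_inter.1 hx).1), mem_erase.2
          ⟨fun h => hpz (h ▸ (mem_inter.1 hx).1), (mem_inter.1 hx).2⟩⟩
      have := card_le_card h5; have := card_erase_of_mem hp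
      have := card_erase_of_mem (mem_erase.2 ⟨hpq.symm, hq⟩)
      have := hcard (L z); have := hL z hz; omega)
  refine ⟨α, hα, α', hα', β, hβ, β', hβ', h1, h2, h3, h4, φ, hφ, fun k hk => ?_⟩
  have := hφL k hk
  simp only [hR, mem_sdiff, mem_insert, mem_singleton, not_or] at this
  exact this

theorem exists_mem_ne_ne {X : Finset ℕ} (hX : 3 ≤ #X) (a b : ℕ) : ∃ x ∈ X, x ≠ a ∧ x ≠ b := by
  obtain ⟨x, hx, hxab⟩ := exists_mem_notMem_of_card_lt_card (s := {a, b}) (t := X)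
    (by have := card_le_two (a := a) (b := b); omega)
  exact ⟨x, hx, by simpa using hxab⟩

/-- The color c is saved at both z and z'. The second saving at z comes from B ∪ B', which is too
large to lie in the list of z with c added. -/
theorem PairsColorable.of_mem_union {K : Finset E} {L : E → Finset ℕ} {A A' B B' : Finset ℕ}
    (hL : ∀ k ∈ K, #(L k) = #K + 2) (hA' : 3 ≤ #A') (hB : 3 ≤ #B) (hB' : 3 ≤ #B')
    (hdB : Disjoint B B') (hcard : #K + 4 ≤ #B + #B') {z z' : E} (hz : z ∈ K)
    (hz' : z' ∈ K) (hne : z ≠ z') {c : ℕ} (hc : c ∈ A) (hcz : c ∉ L z) (hcz' : c ∉ L z') :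
    PairsColorable K L A A' B B' := by
  obtain ⟨q, hq, hqz⟩ := exists_mem_notMem_of_card_lt_card (s := insert c (L z)) (t := B ∪ B') (by
    rw [card_union_of_disjoint hdB]
    have := card_insert_le c (L z); have := hL z hz; omega)
  rw [mem_insert, not_or] at hqz
  rcases mem_union.1 hq with hq | hq
  · obtain ⟨β', hβ', h1, -⟩ := exists_mem_ne_ne hB' c c
    obtain ⟨α', hα', h2, h3⟩ := exists_mem_ne_ne hA' q β'
    exact of_saved hL hc hα' hq hβ' (Ne.symm hqz.1) h1.symm h2 h3 hz hz' hne (p := c) (q := q)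
      (r := c) (by simp) (by simp) (by simp) (Ne.symm hqz.1) hcz hqz.2 hcz'
  · obtain ⟨β, hβ, h1, -⟩ := exists_mem_ne_ne hB c c
    obtain ⟨α', hα', h2, h3⟩ := exists_mem_ne_ne hA' q β
    exact of_saved hL hc hα' hβ hq h1.symm (Ne.symm hqz.1) h3 h2 hz hz' hne (p := c) (q := q)
      (r := c) (by simp) (by simp) (by simp) (Ne.symm hqz.1) hcz hqz.2 hcz'

theorem PairsColorable.of_split {K : Finset E} {L : E → Finset ℕ} {A A' B B' : Finset ℕ}
    (hL : ∀ k ∈ K, #(L k) = #K + 2) (hA : 3 ≤ #A) (hB : 3 ≤ #B) (hB' : 3 ≤ #B')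
    (hdB : Disjoint B B') (hcard : #K + 4 ≤ #B + #B') {z z' : E} (hz : z ∈ K)
    (hz' : z' ∈ K) (hne : z ≠ z') {p r : ℕ} (hp : p ∈ A) (hpz : p ∉ L z) (hr : r ∈ A')
    (hrz' : r ∉ L z') : PairsColorable K L A A' B B' := by
  obtain ⟨q, hq, hqz⟩ := exists_mem_notMem_of_card_lt_card (s := insert p (L z)) (t := B ∪ B') (by
    rw [card_union_of_disjoint hdB]
    have := card_insert_le p (L z); have := hL z hz; omega)
  rw [mem_insert, not_or] at hqz
  -- If the colors coincide, then r is missing at both z and z', and the preceding case applies with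
  -- the first pair exchanged.
  by_cases hqr : q = r
  · subst hqr
    exact (of_mem_union hL hA hB hB' hdB hcard hz hz' hne hr hqz.2 hrz').swap_left
  rcases mem_union.1 hq with hq | hq
  · obtain ⟨β', hβ', h1, h2⟩ := exists_mem_ne_ne hB' p r
    exact of_saved hL hp hr hq hβ' (Ne.symm hqz.1) h1.symm (Ne.symm hqr) h2.symm hz hz' hne
      (p := p) (q := q) (r := r) (by simp) (by simp) (by simp) (Ne.symm hqz.1) hpz hqz.2 hrz'
  · obtain ⟨β, hβ, h1, h2⟩ := exists_mem_ne_ne hB p r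
    exact of_saved hL hp hr hβ hq h1.symm (Ne.symm hqz.1) h2.symm (Ne.symm hqr) hz hz' hne
      (p := p) (q := q) (r := r) (by simp) (by simp) (by simp) (Ne.symm hqz.1) hpz hqz.2 hrz'

/-- If all lists on `K` contain `A'`, then the parts of `A` outside them overlap. -/
theorem exists_common_missing {K : Finset E} {L : E → Finset ℕ} {A A' : Finset ℕ}
    (hL : ∀ k ∈ K, #(L k) = #K + 2) (hK : 3 ≤ #K) (hK4 : #K ≤ 4) (hA' : 3 ≤ #A')
    (hcard : #K + 4 ≤ #A + #A') (hd : Disjoint A A') (hsub : ∀ k ∈ K, A' ⊆ L k) :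
    ∃ z ∈ K, ∃ z' ∈ K, z ≠ z' ∧ ∃ c ∈ A, c ∉ L z ∧ c ∉ L z' := by
  by_contra hcon
  push Not at hcon
  have hsize : ∀ k ∈ K, #A + #A' ≤ #(A \ L k) + (#K + 2) := by
    intro k hk
    have h1 : #A + #A' = #(A ∪ A') := (card_union_of_disjoint hd).symm
    have h2 : A ∪ A' ⊆ A \ L k ∪ L k := by
      intro x hx
      simp only [mem_union, mem_sdiff] at hx ⊢
      rcases hx with hx | hx
      · tauto
      · exact Or.inr (hsub k hk hx)
    have h3 := (card_le_card h2).trans (card_union_le _ _)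
    have := hL k hk
    omega
  have hdisj : ∀ k ∈ K, ∀ k' ∈ K, k ≠ k' → Disjoint (A \ L k) (A \ L k') := by
    intro k hk k' hk' hne
    refine disjoint_left.2 fun x hx hx' => ?_
    rw [mem_sdiff] at hx hx'
    exact hx'.2 (hcon k hk k' hk' hne x hx.1 hx.2)
  have h1 : #(K.biUnion fun k => A \ L k) = ∑ k ∈ K, #(A \ L k) :=
    card_biUnion hdisj
  have h2 : #(K.biUnion fun k => A \ L k) ≤ #A :=
    card_le_card (biUnion_subset.2 fun _ _ => sdiff_subset)
  have h3 : #K * (#A + #A' - (#K + 2)) ≤ ∑ k ∈ K, #(A \ L k) := by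
    rw [← smul_eq_mul]
    exact card_nsmul_le_sum _ _ _ fun k hk => by have := hsize k hk; omega
  -- Three disjoint missing parts would have to fit in A, which together with 3 ≤ #A' forces #K ≥ 5.
  have h4 : 3 * (#A + #A' - (#K + 2)) ≤ #K * (#A + #A' - (#K + 2)) := Nat.mul_le_mul_right _ hK
  omega

/-- With lists cut down to #K + 2 and both pairs of lists disjoint, it remains to find savings from
A ∪ A' at two vertices of K: either one color missing at both, or a color of A missing at one and a
color of A' missing at the other. -/
theorem pairsColorable (K : Finset E) (L : E → Finset ℕ) (A A' B B' : Finset ℕ)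
    (hL : ∀ k ∈ K, #K + 2 ≤ #(L k)) (hK : 3 ≤ #K) (hK4 : #K ≤ 4) (hA : 3 ≤ #A) (hA' : 3 ≤ #A')
    (hB : 3 ≤ #B) (hB' : 3 ≤ #B') (hAA : #K + 4 ≤ #A + #A') (hBB : #K + 4 ≤ #B + #B') :
    PairsColorable K L A A' B B' := by
  have htrim : ∀ k, ∃ T ⊆ L k, k ∈ K → #T = #K + 2 := by
    intro k
    by_cases hk : k ∈ K
    · obtain ⟨T, hT, h⟩ := exists_subset_card_eq (hL k hk)
      exact ⟨T, hT, fun _ => h⟩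
    · exact ⟨L k, Subset.rfl, fun h => absurd h hk⟩
  choose L' hL'L hL' using htrim
  refine PairsColorable.mono (L := L') ?_ fun k _ => hL'L k
  by_cases hcA : ∃ c, c ∈ A ∧ c ∈ A'
  · obtain ⟨c, h1, h2⟩ := hcA
    exact .of_common hL' hB hB' hBB h1 h2
  by_cases hcB : ∃ c, c ∈ B ∧ c ∈ B'
  · obtain ⟨c, h1, h2⟩ := hcB
    exact .swap (.of_common hL' hA hA' hAA h1 h2)
  have hdA : Disjoint A A' := disjoint_left.2 fun x hx hx' => hcA ⟨x, hx, hx'⟩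
  have hdB : Disjoint B B' := disjoint_left.2 fun x hx hx' => hcB ⟨x, hx, hx'⟩
  by_cases hs1 : ∀ k ∈ K, A' ⊆ L' k
  · obtain ⟨z, hz, z', hz', hne, c, hc, h1, h2⟩ :=
      exists_common_missing hL' hK hK4 hA' hAA hdA hs1
    exact .of_mem_union hL' hA' hB hB' hdB hBB hz hz' hne hc h1 h2
  by_cases hs2 : ∀ k ∈ K, A ⊆ L' k
  · obtain ⟨z, hz, z', hz', hne, c, hc, h1, h2⟩ :=
      exists_common_missing hL' hK hK4 hA (by omega) hdA.symm hs2
    exact .swap_left (.of_mem_union hL' hA hB hB' hdB hBB hz hz' hne hc h1 h2)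
  have hex : ∃ z ∈ K, ∃ z' ∈ K, z ≠ z' ∧ (∃ p ∈ A, p ∉ L' z) ∧ ∃ r ∈ A', r ∉ L' z' := by
    by_contra hcon
    push Not at hcon hs1 hs2
    obtain ⟨j, hj, hs1⟩ := hs1
    obtain ⟨i, hi, hs2⟩ := hs2
    obtain ⟨r, hr, hrj⟩ := not_subset.1 hs1
    obtain ⟨p, hp, hpi⟩ := not_subset.1 hs2
    have hij : i = j := by
      by_contra hij
      exact hrj (hcon i hi j hj hij ⟨p, hp, hpi⟩ r hr)
    subst hij
    -- All missing colors are now concentrated at i, so the list of any other k contains A ∪ A',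
    -- which is too large.
    obtain ⟨k, hk, hki⟩ := exists_mem_ne (by omega : 1 < #K) i
    have h1 : A' ⊆ L' k := fun x hx => hcon i hi k hk hki.symm ⟨p, hp, hpi⟩ x hx
    have h2 : A ⊆ L' k := fun x hx => by
      by_contra hxk
      exact hrj (hcon k hk i hi hki ⟨x, hx, hxk⟩ r hr)
    have h3 := card_le_card (union_subset h2 h1)
    rw [card_union_of_disjoint hdA] at h3
    have := hL' k hk
    omega
  obtain ⟨z, hz, z', hz', hne, ⟨p, hp, hpz⟩, r, hr, hrz⟩ := hex
  exact .of_split hL' hA hB hB' hdB hBB hz hz' hne hp hpz hr hrz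

end Lists

/-! ### Critical edge sets and their reducible bipartite subgraphs -/

section Critical
open scoped Classical
open Finset

variable {V E : Type*} (s : E → Sym2 V)

/-- Adjacency in the line graph of the multigraph whose edge `e` has the ends `s e`. -/
def LAdj (e f : E) : Prop := e ≠ f ∧ ∃ x, x ∈ s e ∧ x ∈ s f

/-- The degree of `e` in the line graph of the multigraph with edge set `F`. -/
noncomputable def ldeg (F : Finset E) (e : E) : ℕ := #{f ∈ F | LAdj s e f}

/-- The degree of the vertex `x` in the multigraph with edge set `F`. -/
noncomputable def vdeg (F : Finset E) (x : V) : ℕ := #{f ∈ F | x ∈ s f}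

/-- The number of edges in `F` with ends `a`. -/
noncomputable def mult (F : Finset E) (a : Sym2 V) : ℕ := #{f ∈ F | s f = a}

/-- The edges in `S` can be properly colored from the lists `L`. -/
def ListColorable (S : Finset E) (L : E → Finset ℕ) : Prop :=
  ∃ φ : E → ℕ, (∀ e ∈ S, φ e ∈ L e) ∧ ∀ e ∈ S, ∀ f ∈ S, LAdj s e f → φ e ≠ φ f

/-- The properties of the edge set of a minimal counterexample. -/
structure IsCritical (F : Finset E) (k : ℕ) : Prop where
  not_isDiag : ∀ e ∈ F, ¬ (s e).IsDiag
  exists_lists : ∀ S ⊆ F, S.Nonempty → ∃ L : E → Finset ℕ,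
    (∀ e ∈ S, k + ldeg s S e ≤ #(L e) + ldeg s F e) ∧ ¬ ListColorable s S L
  ldeg_le : ∀ e ∈ F, ldeg s F e ≤ k + 1
  card_clique_le : ∀ Q ⊆ F, (∀ e ∈ Q, ∀ f ∈ Q, e ≠ f → LAdj s e f) → #Q ≤ k
  le_vdeg : ∀ e ∈ F, ∀ x ∈ s e, ldeg s F e + 6 ≤ vdeg s F x + k

variable {s} {F : Finset E} {k : ℕ}

theorem LAdj.symm {e f : E} (h : LAdj s e f) : LAdj s f e :=
  ⟨h.1.symm, h.2.imp fun _ hx => hx.symm⟩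

theorem card_le_ldeg {S T : Finset E} {e : E} (hTS : T ⊆ S) (h : ∀ f ∈ T, LAdj s e f) :
    #T ≤ ldeg s S e :=
  card_le_card fun f hf => mem_filter.2 ⟨hTS hf, h f hf⟩

/-- Inclusion–exclusion for the edges at u and at v; the summand 1 is e itself. -/
theorem ldeg_add_mult {e : E} {u v : V} (he : e ∈ F) (hs : s e = s(u, v)) (huv : u ≠ v) :
    ldeg s F e + mult s F s(u, v) + 1 = vdeg s F u + vdeg s F v := by
  have h1 := card_union_add_card_inter {f ∈ F | u ∈ s f} {f ∈ F | v ∈ s f}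
  have h2 : {f ∈ F | u ∈ s f} ∪ {f ∈ F | v ∈ s f} = insert e {f ∈ F | LAdj s e f} := by
    ext f
    simp only [mem_union, mem_filter, mem_insert, LAdj, hs, Sym2.mem_iff]
    constructor
    · intro h
      by_cases hef : f = e
      · exact Or.inl hef
      · rcases h with h | h
        · exact Or.inr ⟨h.1, Ne.symm hef, u, Or.inl rfl, h.2⟩
        · exact Or.inr ⟨h.1, Ne.symm hef, v, Or.inr rfl, h.2⟩
    · rintro (rfl | ⟨hf, -, x, rfl | rfl, hx⟩)
      · simp [he, hs]
      · exact Or.inl ⟨hf, hx⟩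
      · exact Or.inr ⟨hf, hx⟩
  have h3 : {f ∈ F | u ∈ s f} ∩ {f ∈ F | v ∈ s f} = {f ∈ F | s f = s(u, v)} := by
    ext f
    simp only [mem_inter, mem_filter]
    constructor
    · rintro ⟨⟨h1, h2⟩, -, h3⟩
      exact ⟨h1, (Sym2.mem_and_mem_iff huv).1 ⟨h2, h3⟩⟩
    · rintro ⟨h1, h2⟩
      simp [h1, h2]
  rw [h2, h3, card_insert_of_notMem fun hmem => (mem_filter.1 hmem).2.1 rfl] at h1
  simp only [ldeg, mult, vdeg]
  omega

namespace IsCritical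

theorem exists_ends (h : IsCritical s F k) {e : E} (he : e ∈ F) {x : V} (hx : x ∈ s e) :
    ∃ y, x ≠ y ∧ s e = s(x, y) := by
  obtain ⟨y, hy⟩ := Sym2.mem_iff_exists.1 hx
  refine ⟨y, fun hxy => h.not_isDiag e he ?_, hy⟩
  rw [hy, hxy]
  exact Sym2.mk_isDiag_iff.2 rfl

theorem le_ldeg (h : IsCritical s F k) {e : E} (he : e ∈ F) : k ≤ ldeg s F e := by
  by_contra hlt
  obtain ⟨L, hL, hcol⟩ := h.exists_lists {e} (singleton_subset_iff.2 he) (singleton_nonempty e)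
  have h1 := hL e (mem_singleton_self e)
  obtain ⟨a, ha⟩ : (L e).Nonempty := card_pos.1 (by omega)
  exact hcol ⟨fun _ => a, by simpa using ha, by simp [LAdj]⟩

theorem six_le_vdeg (h : IsCritical s F k) {e : E} (he : e ∈ F) {x : V} (hx : x ∈ s e) :
    6 ≤ vdeg s F x := by
  have h1 := h.le_vdeg e he x hx
  have h2 := h.le_ldeg he
  omega

/-- The hypothesis `hout` makes the lists left on S longer than the number of preferred edges, so
Galvin's argument colors S. -/
theorem false_of_beats (h : IsCritical s F k) {S : Finset E} (hSF : S ⊆ F) (hS : S.Nonempty)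
    {l r : E → V} (hlr : ∀ e ∈ S, s e = s(l e, r e)) (hbip : ∀ e ∈ S, ∀ f ∈ S, l e ≠ r f)
    {c : E → ℕ} (hc : ProperOn S l r c)
    (hout : ∀ e ∈ S, #{f ∈ S | Beats l r c f e} + ldeg s F e < k + ldeg s S e) : False := by
  obtain ⟨L, hL, hcol⟩ := h.exists_lists S hSF hS
  obtain ⟨φ, hφL, hφ⟩ := exists_coloring_of_card_beats_lt l r c S hc L fun e he => by
    have := hL e he
    have := hout e he
    omega
  refine hcol ⟨φ, hφL, fun e he f hf ⟨hef, x, hxe, hxf⟩ => hφ e he f hf hef ?_⟩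
  rw [hlr e he, Sym2.mem_iff] at hxe
  rw [hlr f hf, Sym2.mem_iff] at hxf
  rcases hxe with rfl | rfl <;> rcases hxf with hx | hx
  · exact Or.inl hx
  · exact absurd hx (hbip e he f hf)
  · exact absurd hx.symm (hbip f hf e he)
  · exact Or.inr hx

/-- A choice of the ends of the edges in a bipartite multigraph. -/
theorem exists_left_right {S : Finset E} (hS : S.Nonempty) {W : Set V}
    (hW : ∀ e ∈ S, ∃ x y, s e = s(x, y) ∧ x ∉ W ∧ y ∈ W) :
    ∃ l r : E → V, ∀ e ∈ S, s e = s(l e, r e) ∧ l e ∉ W ∧ r e ∈ W := by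
  have : ∀ e, ∃ p : V × V, e ∈ S → s e = s(p.1, p.2) ∧ p.1 ∉ W ∧ p.2 ∈ W := by
    intro e
    by_cases he : e ∈ S
    · obtain ⟨x, y, hxy⟩ := hW e he
      exact ⟨(x, y), fun _ => hxy⟩
    · obtain ⟨e₀, he₀⟩ := hS
      obtain ⟨x, y, hxy⟩ := hW e₀ he₀
      exact ⟨(x, y), fun h => absurd h he⟩
  choose p hp using this
  exact ⟨fun e => (p e).1, fun e => (p e).2, hp⟩

/-- A bipartite set of edges in which each edge is sufficiently often preferred cannot occur. Edges
prefer large values of `c` at the vertices outside `W` and small values at those in `W`. -/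
theorem false_of_credits (h : IsCritical s F k) {S : Finset E} (hSF : S ⊆ F) (hS : S.Nonempty)
    {W : Set V} (hW : ∀ e ∈ S, ∃ x y, s e = s(x, y) ∧ x ∉ W ∧ y ∈ W) (c : E → ℕ)
    (hQ : ∀ e ∈ S, ∃ Q ⊆ S, ldeg s F e + 1 ≤ k + #Q ∧ ∀ f ∈ Q, (∃ x, x ∈ s e ∧ x ∈ s f) ∧
      ∀ x, x ∈ s e → x ∈ s f → (x ∉ W → c f < c e) ∧ (x ∈ W → c e < c f)) : False := by
  obtain ⟨l, r, hlr⟩ := exists_left_right hS hW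
  -- An injective tie-breaker smaller than #S + 1: scaling c by #S + 1 and adding it separates equal
  -- values and keeps strict inequalities.
  set ι : E → ℕ := fun e => if he : e ∈ S then (S.equivFin ⟨e, he⟩ : ℕ) else 0 with hι
  have hιlt : ∀ e, ι e < #S + 1 := by
    intro e
    by_cases he : e ∈ S
    · simp only [hι, he, dif_pos]
      exact (S.equivFin ⟨e, he⟩).2.trans (Nat.lt_succ_self _)
    · simp [hι, he]
  have hιinj : ∀ e ∈ S, ∀ f ∈ S, ι e = ι f → e = f := by
    intro e he f hf hef
    simp only [hι, he, hf, dif_pos] at hef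
    simpa using S.equivFin.injective (Fin.ext hef)
  set c' : E → ℕ := fun e => c e * (#S + 1) + ι e with hc'
  have hlt : ∀ e f, c e < c f → c' e < c' f := by
    intro e f hef
    have h1 : (c e + 1) * (#S + 1) ≤ c f * (#S + 1) := Nat.mul_le_mul_right _ hef
    have h2 := hιlt e
    simp only [hc']
    rw [add_mul, one_mul] at h1
    omega
  have hinj : ∀ e ∈ S, ∀ f ∈ S, e ≠ f → c' e ≠ c' f := by
    intro e he f hf hef heq
    rcases lt_trichotomy (c e) (c f) with h1 | h1 | h1
    · exact (hlt e f h1).ne heq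
    · refine hef (hιinj e he f hf ?_)
      simp only [hc', h1] at heq
      omega
    · exact (hlt f e h1).ne heq.symm
  refine h.false_of_beats hSF hS (fun e he => (hlr e he).1)
    (fun e he f hf hef => (hlr e he).2.1 (hef ▸ (hlr f hf).2.2)) (c := c')
    (fun e he f hf hef _ => hinj e he f hf hef) fun e he => ?_
  obtain ⟨Q, hQS, hcard, hQ⟩ := hQ e he
  have hmeml : ∀ f ∈ S, l f ∈ s f := fun f hf => by rw [(hlr f hf).1]; simp
  have hmemr : ∀ f ∈ S, r f ∈ s f := fun f hf => by rw [(hlr f hf).1]; simp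
  have hdisj : Disjoint {f ∈ S | Beats l r c' f e} Q := by
    refine disjoint_left.2 fun f hf hfQ => ?_
    obtain ⟨hfS, hb⟩ := mem_filter.1 hf
    rcases hb with ⟨h1, h2⟩ | ⟨h1, h2⟩
    · have := ((hQ f hfQ).2 (l e) (hmeml e he) (h1 ▸ hmeml f hfS)).1 (hlr e he).2.1
      exact lt_asymm h2 (hlt _ _ this)
    · have := ((hQ f hfQ).2 (r e) (hmemr e he) (h1 ▸ hmemr f hfS)).2 (hlr e he).2.2
      exact lt_asymm h2 (hlt _ _ this)
  -- The edges in Q are neighbors of e over which e is preferred, so they are disjoint from the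
  -- edges beating e. One such credit is enough if `ldeg s F e` = k, and two if it is k + 1.
  have hle : #{f ∈ S | Beats l r c' f e} + #Q ≤ ldeg s S e := by
    rw [← card_union_of_disjoint hdisj]
    refine card_le_ldeg (union_subset (filter_subset _ _) hQS) fun f hf => ?_
    rcases mem_union.1 hf with hf | hf
    · obtain ⟨hfS, hb⟩ := mem_filter.1 hf
      rcases hb with ⟨h1, h2⟩ | ⟨h1, h2⟩
      · exact ⟨fun hef => by rw [hef] at h2; exact lt_irrefl _ h2, l e, hmeml e he,
          h1 ▸ hmeml f hfS⟩
      · exact ⟨fun hef => by rw [hef] at h2; exact lt_irrefl _ h2, r e, hmemr e he,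
          h1 ▸ hmemr f hfS⟩
    · refine ⟨fun hef => ?_, (hQ f hf).1⟩
      subst hef
      have := (hQ e hf).2 (l e) (hmeml e he) (hmeml e he)
      exact lt_irrefl _ (this.1 (hlr e he).2.1)
  omega

end IsCritical
end Critical

/-! ### Multiplicity at most three -/

section Local
open scoped Classical
open Finset

variable {V E : Type*} {s : E → Sym2 V} {F : Finset E} {k : ℕ}

theorem listColorable_of_pairsColorable {K : Finset E} {L : E → Finset ℕ} {a a' b b' : E}
    (haK : a ∉ K) (haK' : a' ∉ K) (hbK : b ∉ K) (hbK' : b' ∉ K) (haa : a ≠ a') (hbb : b ≠ b')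
    (hab : a ≠ b) (hab' : a ≠ b') (hba : a' ≠ b) (hba' : a' ≠ b') (hna : ¬ LAdj s a a')
    (hnb : ¬ LAdj s b b') (hp : PairsColorable K L (L a) (L a') (L b) (L b')) :
    ListColorable s (K ∪ {a, a', b, b'}) L := by
  obtain ⟨α, hα, α', hα', β, hβ, β', hβ', h1, h2, h3, h4, φ, hφ, hφL⟩ := hp
  set ψ : E → ℕ := fun f => if f = a then α else if f = a' then α' else if f = b then β else
    if f = b' then β' else φ f with hψ
  have ea : ψ a = α := by simp [hψ]
  have ea' : ψ a' = α' := by simp [hψ, haa.symm]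
  have eb : ψ b = β := by simp [hψ, hab.symm, hba.symm]
  have eb' : ψ b' = β' := by simp [hψ, hab'.symm, hba'.symm, hbb.symm]
  have eK : ∀ f ∈ K, ψ f = φ f := fun f hf => by
    have : f ≠ a ∧ f ≠ a' ∧ f ≠ b ∧ f ≠ b' :=
      ⟨fun h => haK (h ▸ hf), fun h => haK' (h ▸ hf), fun h => hbK (h ▸ hf), fun h => hbK' (h ▸ hf)⟩
    simp [hψ, this]
  have hmem : ∀ f, f ∈ K ∪ {a, a', b, b'} → f ∈ K ∨ f = a ∨ f = a' ∨ f = b ∨ f = b' := by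
    intro f hf
    simpa only [mem_union, mem_insert, mem_singleton] using hf
  refine ⟨ψ, fun f hf => ?_, fun e he f hf hadj => ?_⟩
  · rcases hmem f hf with hf | rfl | rfl | rfl | rfl
    · rw [eK f hf]; exact (hφL f hf).1
    · rwa [ea]
    · rwa [ea']
    · rwa [eb]
    · rwa [eb']
  · have hloop : ∀ e, ¬ LAdj s e e := fun e h => h.1 rfl
    rcases hmem e he with he' | rfl | rfl | rfl | rfl <;>
      rcases hmem f hf with hf' | rfl | rfl | rfl | rfl
    · rw [eK e he', eK f hf']
      exact fun h => hadj.1 (hφ he' hf' h)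
    all_goals first
      | exact absurd hadj (hloop _)
      | exact absurd hadj hna
      | exact absurd hadj.symm hna
      | exact absurd hadj hnb
      | exact absurd hadj.symm hnb
      | (simp only [ea, ea', eb, eb']; first | assumption | (apply Ne.symm; assumption))
      | (rw [eK e he']; have := hφL e he'; simp only [ea, ea', eb, eb']; tauto)
      | (rw [eK f hf']; have := hφL f hf'; simp only [ea, ea', eb, eb']; apply Ne.symm; tauto)

theorem listColorable_of_pair {K : Finset E} {L : E → Finset ℕ} {a a' : E}
    (haK : a ∉ K) (haK' : a' ∉ K) (haa : a ≠ a') (hna : ¬ LAdj s a a')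
    (hp : ∃ α ∈ L a, ∃ α' ∈ L a', ∃ φ : E → ℕ, Set.InjOn φ K ∧
      ∀ k ∈ K, φ k ∈ L k ∧ φ k ≠ α ∧ φ k ≠ α') :
    ListColorable s (K ∪ {a, a'}) L := by
  obtain ⟨α, hα, α', hα', φ, hφ, hφL⟩ := hp
  set ψ : E → ℕ := fun f => if f = a then α else if f = a' then α' else φ f with hψ
  have ea : ψ a = α := by simp [hψ]
  have ea' : ψ a' = α' := by simp [hψ, haa.symm]
  have eK : ∀ f ∈ K, ψ f = φ f := fun f hf => by
    have : f ≠ a ∧ f ≠ a' := ⟨fun h => haK (h ▸ hf), fun h => haK' (h ▸ hf)⟩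
    simp [hψ, this]
  have hmem : ∀ f, f ∈ K ∪ {a, a'} → f ∈ K ∨ f = a ∨ f = a' := by
    intro f hf
    simpa only [mem_union, mem_insert, mem_singleton] using hf
  refine ⟨ψ, fun f hf => ?_, fun e he f hf hadj => ?_⟩
  · rcases hmem f hf with hf | rfl | rfl
    · rw [eK f hf]; exact (hφL f hf).1
    · rwa [ea]
    · rwa [ea']
  · have hloop : ∀ e, ¬ LAdj s e e := fun e h => h.1 rfl
    rcases hmem e he with he' | rfl | rfl <;> rcases hmem f hf with hf' | rfl | rfl
    · rw [eK e he', eK f hf']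
      exact fun h => hadj.1 (hφ he' hf' h)
    all_goals first
      | exact absurd hadj (hloop _)
      | exact absurd hadj hna
      | exact absurd hadj.symm hna
      | (rw [eK e he']; have := hφL e he'; simp only [ea, ea']; tauto)
      | (rw [eK f hf']; have := hφL f hf'; simp only [ea, ea']; apply Ne.symm; tauto)

namespace IsCritical

/-- A large set of edges meeting `u` or `v` contains nonadjacent edges, one at each. -/
theorem exists_not_adj (h : IsCritical s F k) {u v : V} {T : Finset E} (hTF : T ⊆ F)
    (hT : ∀ f ∈ T, u ∈ s f ∨ v ∈ s f) (hk : k < #T) :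
    ∃ x ∈ T, ∃ y ∈ T, u ∈ s x ∧ v ∉ s x ∧ v ∈ s y ∧ u ∉ s y ∧ ¬ LAdj s x y := by
  by_contra hcon
  refine not_le.2 hk (h.card_clique_le T hTF fun e he f hf hef => ?_)
  by_contra hadj
  have hnot : ∀ x, x ∈ s e → x ∉ s f := fun x h1 h2 => hadj ⟨hef, x, h1, h2⟩
  have hadj' : ¬ LAdj s f e := fun h => hadj h.symm
  rcases hT e he with h1 | h1 <;> rcases hT f hf with h2 | h2
  · exact hnot u h1 h2
  · exact hcon ⟨e, he, f, hf, h1, fun h3 => hnot v h3 h2, h2, hnot u h1, hadj⟩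
  · exact hcon ⟨f, hf, e, he, h2, hnot v h1, h1, fun h3 => hnot u h3 h2, hadj'⟩
  · exact hnot v h1 h2

theorem card_filter_or {e : E} {u v : V} (he : e ∈ F) (hs : s e = s(u, v)) :
    #{f ∈ F | u ∈ s f ∨ v ∈ s f} = ldeg s F e + 1 := by
  rw [ldeg, ← card_insert_of_notMem (a := e) fun hmem => (mem_filter.1 hmem).2.1 rfl]
  congr 1
  ext f
  simp only [mem_filter, mem_insert, LAdj, hs, Sym2.mem_iff]
  constructor
  · rintro ⟨hf, hx⟩
    by_cases hef : f = e
    · exact Or.inl hef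
    · rcases hx with hx | hx
      · exact Or.inr ⟨hf, Ne.symm hef, u, Or.inl rfl, hx⟩
      · exact Or.inr ⟨hf, Ne.symm hef, v, Or.inr rfl, hx⟩
  · rintro (rfl | ⟨hf, -, x, rfl | rfl, hx⟩)
    · simp [he, hs]
    · exact ⟨hf, Or.inl hx⟩
    · exact ⟨hf, Or.inr hx⟩

/-- An edge of K meets all #K + 3 other edges, so it keeps #K + 2 colors, and each pair member keeps
at least #K. For #K = 3 the adjacency of a and b' gives each pair the one extra color it needs. -/
theorem false_of_pairs (h : IsCritical s F k) {u v : V} {K : Finset E} (hKF : K ⊆ F)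
    (hKs : ∀ e ∈ K, s e = s(u, v)) (hK3 : 3 ≤ #K) (hK4 : #K ≤ 4) {a a' b b' : E} (ha : a ∈ F)
    (ha' : a' ∈ F) (hb : b ∈ F) (hb' : b' ∈ F) (hau : u ∈ s a) (hav : v ∉ s a) (hbu : u ∈ s b)
    (hbv : v ∉ s b) (hav' : v ∈ s a') (hau' : u ∉ s a') (hbv' : v ∈ s b') (hbu' : u ∉ s b')
    (hab : a ≠ b) (hab' : a' ≠ b') (hna : ¬ LAdj s a a') (hnb : ¬ LAdj s b b')
    (hor : #K = 4 ∨ LAdj s a b') : False := by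
  have hnK : ∀ f, f ∈ K → u ∈ s f ∧ v ∈ s f := fun f hf => by rw [hKs f hf]; simp
  have haK : a ∉ K := fun hf => hav (hnK _ hf).2
  have hbK : b ∉ K := fun hf => hbv (hnK _ hf).2
  have haK' : a' ∉ K := fun hf => hau' (hnK _ hf).1
  have hbK' : b' ∉ K := fun hf => hbu' (hnK _ hf).1
  have haa : a ≠ a' := fun h => hav (h ▸ hav')
  have hbb : b ≠ b' := fun h => hbv (h ▸ hbv')
  have hab2 : a ≠ b' := fun h => hav (h ▸ hbv')
  have hba2 : a' ≠ b := fun h => hbv (h ▸ hav')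
  set S := K ∪ {a, a', b, b'} with hS
  have hSF : S ⊆ F := by
    intro f hf
    simp only [hS, mem_union, mem_insert, mem_singleton] at hf
    rcases hf with hf | rfl | rfl | rfl | rfl
    · exact hKF hf
    all_goals assumption
  have hKS : K ⊆ S := subset_union_left
  have haS : a ∈ S := by simp [hS]
  have haS' : a' ∈ S := by simp [hS]
  have hbS : b ∈ S := by simp [hS]
  have hbS' : b' ∈ S := by simp [hS]
  obtain ⟨L, hL, hcol⟩ := h.exists_lists S hSF ⟨a, haS⟩
  have hlist : ∀ e ∈ S, ldeg s S e ≤ #(L e) + 1 := fun e he => by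
    have := hL e he
    have := h.ldeg_le e (hSF he)
    omega
  have hKL : ∀ e ∈ K, #K + 2 ≤ #(L e) := by
    intro e he
    have hsub : S.erase e ⊆ S := erase_subset _ _
    have h1 : #(S.erase e) ≤ ldeg s S e := card_le_ldeg hsub fun f hf => by
      obtain ⟨hfe, hf⟩ := mem_erase.1 hf
      simp only [hS, mem_union, mem_insert, mem_singleton] at hf
      rcases hf with hf | rfl | rfl | rfl | rfl
      · exact ⟨hfe.symm, u, (hnK e he).1, (hnK f hf).1⟩
      · exact ⟨hfe.symm, u, (hnK e he).1, hau⟩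
      · exact ⟨hfe.symm, v, (hnK e he).2, hav'⟩
      · exact ⟨hfe.symm, u, (hnK e he).1, hbu⟩
      · exact ⟨hfe.symm, v, (hnK e he).2, hbv'⟩
    have h2 : #S = #K + 4 := by
      rw [hS, card_union_of_disjoint]
      · rw [card_insert_of_notMem (by simp [haa, hab, hab2]),
          card_insert_of_notMem (by simp [hba2, hab']), card_pair hbb]
      · refine disjoint_left.2 fun f hf hf' => ?_
        simp only [mem_insert, mem_singleton] at hf'
        rcases hf' with rfl | rfl | rfl | rfl <;> contradiction
    have h3 := card_erase_of_mem (hKS he)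
    have h4 := hlist e (hKS he)
    omega
  have hside : ∀ x ∈ S, x ∉ K → ∀ y ∈ S, y ∉ K → LAdj s x y → (∀ f ∈ K, LAdj s x f) →
      #K ≤ #(L x) := by
    intro x hx _ y hy hyK hxy hxK
    have h1 : #(insert y K) ≤ ldeg s S x := card_le_ldeg (insert_subset hy hKS) fun f hf => by
      rcases mem_insert.1 hf with rfl | hf
      · exact hxy
      · exact hxK f hf
    rw [card_insert_of_notMem hyK] at h1
    have := hlist x hx
    omega
  have hside2 : ∀ x ∈ S, ∀ y ∈ S, y ∉ K → ∀ y' ∈ S, y' ∉ K → y ≠ y' → LAdj s x y → LAdj s x y' →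
      (∀ f ∈ K, LAdj s x f) → #K + 1 ≤ #(L x) := by
    intro x hx y hy hyK y' hy' hyK' hne hxy hxy' hxK
    have h1 : #(insert y' (insert y K)) ≤ ldeg s S x :=
      card_le_ldeg (insert_subset hy' (insert_subset hy hKS)) fun f hf => by
        rcases mem_insert.1 hf with rfl | hf
        · exact hxy'
        · rcases mem_insert.1 hf with rfl | hf
          · exact hxy
          · exact hxK f hf
    rw [card_insert_of_notMem (by simp [hne.symm, hyK']), card_insert_of_notMem hyK] at h1
    have := hlist x hx
    omega
  have ka : ∀ f ∈ K, LAdj s a f := fun f hf => ⟨fun h => haK (h ▸ hf), u, hau, (hnK f hf).1⟩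
  have kb : ∀ f ∈ K, LAdj s b f := fun f hf => ⟨fun h => hbK (h ▸ hf), u, hbu, (hnK f hf).1⟩
  have ka' : ∀ f ∈ K, LAdj s a' f := fun f hf => ⟨fun h => haK' (h ▸ hf), v, hav', (hnK f hf).2⟩
  have kb' : ∀ f ∈ K, LAdj s b' f := fun f hf => ⟨fun h => hbK' (h ▸ hf), v, hbv', (hnK f hf).2⟩
  have adab : LAdj s a b := ⟨hab, u, hau, hbu⟩
  have adab' : LAdj s a' b' := ⟨hab', v, hav', hbv'⟩
  have la := hside a haS haK b hbS hbK adab ka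
  have lb := hside b hbS hbK a haS haK adab.symm kb
  have la' := hside a' haS' haK' b' hbS' hbK' adab' ka'
  have lb' := hside b' hbS' hbK' a' haS' haK' adab'.symm kb'
  refine hcol (listColorable_of_pairsColorable haK haK' hbK hbK' haa hbb hab hab2 hba2 hab' hna hnb
    (pairsColorable K L _ _ _ _ hKL hK3 hK4 (by omega) (by omega) (by omega) (by omega) ?_ ?_))
  · rcases hor with h4 | hadj
    · omega
    · have := hside2 a haS b hbS hbK b' hbS' hbK' hbb adab hadj ka
      omega
  · rcases hor with h4 | hadj
    · omega
    · have := hside2 b' hbS' a' haS' haK' a haS haK haa.symm adab'.symm hadj.symm kb'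
      omega

theorem false_of_pair (h : IsCritical s F k) {u v : V} {K : Finset E} (hKF : K ⊆ F)
    (hKs : ∀ e ∈ K, s e = s(u, v)) (hK4 : #K = 4) (hKk : ∀ e ∈ K, ldeg s F e ≤ k) {a a' : E}
    (ha : a ∈ F) (ha' : a' ∈ F) (hau : u ∈ s a) (hav : v ∉ s a) (hav' : v ∈ s a')
    (hau' : u ∉ s a') (hna : ¬ LAdj s a a') : False := by
  have hnK : ∀ f, f ∈ K → u ∈ s f ∧ v ∈ s f := fun f hf => by rw [hKs f hf]; simp
  have haK : a ∉ K := fun hf => hav (hnK _ hf).2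
  have haK' : a' ∉ K := fun hf => hau' (hnK _ hf).1
  have haa : a ≠ a' := fun h => hav (h ▸ hav')
  set S := K ∪ {a, a'} with hS
  have hSF : S ⊆ F := by
    intro f hf
    simp only [hS, mem_union, mem_insert, mem_singleton] at hf
    rcases hf with hf | rfl | rfl
    · exact hKF hf
    all_goals assumption
  have hKS : K ⊆ S := subset_union_left
  have haS : a ∈ S := by simp [hS]
  have haS' : a' ∈ S := by simp [hS]
  obtain ⟨L, hL, hcol⟩ := h.exists_lists S hSF ⟨a, haS⟩
  have hKL : ∀ e ∈ K, #K + 1 ≤ #(L e) := by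
    intro e he
    have h1 : #(S.erase e) ≤ ldeg s S e := card_le_ldeg (erase_subset _ _) fun f hf => by
      obtain ⟨hfe, hf⟩ := mem_erase.1 hf
      simp only [hS, mem_union, mem_insert, mem_singleton] at hf
      rcases hf with hf | rfl | rfl
      · exact ⟨hfe.symm, u, (hnK e he).1, (hnK f hf).1⟩
      · exact ⟨hfe.symm, u, (hnK e he).1, hau⟩
      · exact ⟨hfe.symm, v, (hnK e he).2, hav'⟩
    have h2 : #S = #K + 2 := by
      rw [hS, card_union_of_disjoint, card_pair haa]
      refine disjoint_left.2 fun f hf hf' => ?_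
      simp only [mem_insert, mem_singleton] at hf'
      rcases hf' with rfl | rfl <;> contradiction
    have h3 := card_erase_of_mem (hKS he)
    have h4 := hL e (hKS he)
    have h5 := hKk e he
    omega
  have hside : ∀ x ∈ S, (∀ f ∈ K, LAdj s x f) → #K ≤ #(L x) + 1 := by
    intro x hx hxK
    have h1 : #K ≤ ldeg s S x := card_le_ldeg hKS hxK
    have := hL x hx
    have := h.ldeg_le x (hSF hx)
    omega
  have la := hside a haS fun f hf => ⟨fun h => haK (h ▸ hf), u, hau, (hnK f hf).1⟩
  have la' := hside a' haS' fun f hf => ⟨fun h => haK' (h ▸ hf), v, hav', (hnK f hf).2⟩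
  exact hcol (listColorable_of_pair haK haK' haa hna (exists_choice_pair K L _ _ hKL
    (card_pos.1 (by omega)) (card_pos.1 (by omega)) (by omega)))

/-- The edges meeting u or v outnumber k, so they are not a clique and contain a nonadjacent pair.
One pair suffices if the parallel edges have line degree k. If it is k + 1, such a pair survives the
deletion of any one edge, which yields two disjoint pairs. -/
theorem mult_le_three (h : IsCritical s F k) (u v : V) : mult s F s(u, v) ≤ 3 := by
  by_contra hlt
  obtain ⟨K, hK, hK4⟩ := exists_subset_card_eq (s := {f ∈ F | s f = s(u, v)}) (n := 4)
    (by simp only [mult] at hlt; omega)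
  have hKF : K ⊆ F := hK.trans (filter_subset _ _)
  have hKs : ∀ e ∈ K, s e = s(u, v) := fun e he => (mem_filter.1 (hK he)).2
  obtain ⟨e, he⟩ : K.Nonempty := card_pos.1 (by omega)
  have hcard := card_filter_or (hKF he) (hKs e he)
  have hge := h.le_ldeg (hKF he)
  set N := {f ∈ F | u ∈ s f ∨ v ∈ s f} with hN
  have hNF : N ⊆ F := filter_subset _ _
  have hNs : ∀ f ∈ N, u ∈ s f ∨ v ∈ s f := fun f hf => (mem_filter.1 hf).2
  obtain ⟨x, hx, y, hy, hxu, hxv, hyv, hyu, hxy⟩ := h.exists_not_adj hNF hNs (by omega)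
  by_cases hk : ldeg s F e ≤ k
  · refine h.false_of_pair hKF hKs hK4 (fun f hf => ?_) (hNF hx) (hNF hy) hxu hxv hyv hyu hxy
    have : #N = ldeg s F f + 1 := card_filter_or (hKF hf) (hKs f hf)
    omega
  have herase : ∀ z, ∃ x' ∈ N.erase z, ∃ y' ∈ N.erase z, u ∈ s x' ∧ v ∉ s x' ∧ v ∈ s y' ∧ u ∉ s y' ∧
      ¬ LAdj s x' y' := fun z => h.exists_not_adj ((erase_subset _ _).trans hNF)
    (fun f hf => hNs f (mem_of_mem_erase hf))
    (by have := pred_card_le_card_erase (s := N) (a := z); omega)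
  have key : ∀ {a a' b b' : E}, a ∈ N → a' ∈ N → b ∈ N → b' ∈ N → u ∈ s a → v ∉ s a → u ∈ s b →
      v ∉ s b → v ∈ s a' → u ∉ s a' → v ∈ s b' → u ∉ s b' → a ≠ b → a' ≠ b' → ¬ LAdj s a a' →
      ¬ LAdj s b b' → False := fun {a a' b b'} h1 h2 h3 h4 h5 h6 h7 h8 h9 h10 h11 h12 h13 h14 h15 h16 =>
    h.false_of_pairs hKF hKs (by omega) (by omega) (hNF h1) (hNF h2) (hNF h3) (hNF h4) h5 h6 h7 h8 h9
      h10 h11 h12 h13 h14 h15 h16 (Or.inl hK4)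
  obtain ⟨x₁, hx₁, y₁, hy₁, h1, h2, h3, h4, h5⟩ := herase x
  obtain ⟨x₂, hx₂, y₂, hy₂, g1, g2, g3, g4, g5⟩ := herase y
  rw [mem_erase] at hx₁ hy₁ hx₂ hy₂
  by_cases hyy : y = y₁
  · subst hyy
    by_cases hxx : x = x₂
    · subst hxx
      exact key hx₁.2 hy hx hy₂.2 h1 h2 hxu hxv hyv hyu g3 g4 hx₁.1 (Ne.symm hy₂.1) h5 g5
    · exact key hx hy hx₂.2 hy₂.2 hxu hxv g1 g2 hyv hyu g3 g4 hxx (Ne.symm hy₂.1) hxy g5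
  · exact key hx hy hx₁.2 hy₁.2 hxu hxv h1 h2 hyv hyu h3 h4 (Ne.symm hx₁.1) hyy hxy h5

end IsCritical
end Local

/-! ### Two triple edges never meet -/

section Triples
open scoped Classical
open Finset

variable {V E : Type*} {s : E → Sym2 V} {F : Finset E} {k : ℕ}

theorem eq_of_mem_of_mem {x a b c : V} (hbc : b ≠ c) (h1 : x ∈ s(a, b)) (h2 : x ∈ s(a, c)) :
    x = a := by
  rw [Sym2.mem_iff] at h1 h2
  rcases h1 with h1 | h1
  · exact h1
  · rcases h2 with h2 | h2
    · exact h2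
    · exact absurd (h1.symm.trans h2) hbc

theorem credit_left {e f : E} {x p q : V} {W : Set V} {c : E → ℕ} (he : s e = s(x, p))
    (hf : s f = s(x, q)) (hpq : p ≠ q) (hx : x ∉ W) (hc : c f < c e) :
    (∃ x, x ∈ s e ∧ x ∈ s f) ∧
      ∀ x, x ∈ s e → x ∈ s f → (x ∉ W → c f < c e) ∧ (x ∈ W → c e < c f) := by
  rw [he, hf]
  refine ⟨⟨x, by simp, by simp⟩, fun y hy hy' => ⟨fun _ => hc, fun hyW => ?_⟩⟩
  exact absurd (eq_of_mem_of_mem hpq hy hy' ▸ hyW) hx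

theorem credit_right {e f : E} {x p q : V} {W : Set V} {c : E → ℕ} (he : s e = s(x, p))
    (hf : s f = s(x, q)) (hpq : p ≠ q) (hx : x ∈ W) (hc : c e < c f) :
    (∃ x, x ∈ s e ∧ x ∈ s f) ∧
      ∀ x, x ∈ s e → x ∈ s f → (x ∉ W → c f < c e) ∧ (x ∈ W → c e < c f) := by
  rw [he, hf]
  refine ⟨⟨x, by simp, by simp⟩, fun y hy hy' => ⟨fun hyW => ?_, fun _ => hc⟩⟩
  exact absurd (eq_of_mem_of_mem hpq hy hy' ▸ hx) hyW

theorem exists_of_le_mult {n : ℕ} {a : Sym2 V} (h : n + 1 ≤ mult s F a) :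
    ∃ e ∈ F, s e = a ∧ n ≤ #({f ∈ F | s f = a}.erase e) := by
  obtain ⟨e, he⟩ : ({f ∈ F | s f = a}).Nonempty := card_pos.1 (by simp only [mult] at h; omega)
  refine ⟨e, (mem_filter.1 he).1, (mem_filter.1 he).2, ?_⟩
  rw [card_erase_of_mem he]
  simp only [mult] at h
  omega

namespace IsCritical

theorem false_of_triples_of_vdeg_eq_six (h : IsCritical s F k) {u v₁ v₂ : V} (hu₁ : u ≠ v₁)
    (hu₂ : u ≠ v₂) (hv : v₁ ≠ v₂) (h₁ : 3 ≤ mult s F s(u, v₁)) (h₂ : 3 ≤ mult s F s(u, v₂))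
    (hd : vdeg s F u = 6) : False := by
  have hedge : ∀ f ∈ F, u ∈ s f → s f = s(u, v₁) ∨ s f = s(u, v₂) := by
    have hsub : {f ∈ F | s f = s(u, v₁)} ∪ {f ∈ F | s f = s(u, v₂)} ⊆ {f ∈ F | u ∈ s f} := by
      intro f hf
      simp only [mem_union, mem_filter] at hf ⊢
      rcases hf with ⟨h1, h2⟩ | ⟨h1, h2⟩ <;> simp [h1, h2]
    have hcard : #({f ∈ F | s f = s(u, v₁)} ∪ {f ∈ F | s f = s(u, v₂)}) =
        mult s F s(u, v₁) + mult s F s(u, v₂) := by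
      refine card_union_of_disjoint (disjoint_left.2 fun f hf hf' => hv ?_)
      have h3 := (mem_filter.1 hf).2.symm.trans (mem_filter.1 hf').2
      exact Sym2.congr_right.1 h3
    have heq := eq_of_subset_of_card_le hsub (by rw [hcard]; simp only [vdeg] at hd; omega)
    intro f hf huf
    have : f ∈ {f ∈ F | u ∈ s f} := mem_filter.2 ⟨hf, huf⟩
    rw [← heq] at this
    simp only [mem_union, mem_filter] at this
    tauto
  have hldeg : ∀ f ∈ F, u ∈ s f → ldeg s F f ≤ k := fun f hf huf => by
    have := h.le_vdeg f hf u huf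
    omega
  obtain ⟨k₁, hk₁, hsk₁, hcard₁⟩ := exists_of_le_mult h₁
  obtain ⟨k₂, hk₂, hsk₂, -⟩ := exists_of_le_mult h₂
  obtain ⟨x, hx, y, hy, hxu, hxv, hyv, hyu, hxy⟩ := h.exists_not_adj (u := u) (v := v₁)
    (filter_subset (fun f => u ∈ s f ∨ v₁ ∈ s f) F) (fun f hf => (mem_filter.1 hf).2) (by
      have := card_filter_or hk₁ hsk₁
      have := h.le_ldeg hk₁
      omega)
  replace hx := (mem_filter.1 hx).1
  replace hy := (mem_filter.1 hy).1
  have hsx : s x = s(u, v₂) := (hedge x hx hxu).resolve_left fun h3 => hxv (by simp [h3])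
  obtain ⟨z, hz₁, hsy⟩ := h.exists_ends hy hyv
  have hzu : z ≠ u := fun h3 => hyu (by simp [hsy, h3])
  have hz₂ : z ≠ v₂ := fun h3 => hxy ⟨fun h4 => hyu (h4 ▸ hxu), v₂, by simp [hsx], by simp [hsy, h3]⟩
  have huy : ∀ f, u ∈ s f → f ≠ y := fun f hf h3 => hyu (h3 ▸ hf)
  -- Edges at u need one credit each. At v₁, k₁ is preferred to y, and y to the other two edges u
  -- v₁; at u, the latter are preferred to k₂, and the edges u v₂ to k₁.
  set c : E → ℕ := fun f => if f = k₁ then 0 else if f = y then 1 else if v₁ ∈ s f then 2 else 1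
    with hc
  have hck₁ : c k₁ = 0 := by simp [hc]
  have hcy : c y = 1 := by simp [hc, (huy k₁ (by simp [hsk₁])).symm]
  have hcA : ∀ f, s f = s(u, v₁) → f ≠ k₁ → c f = 2 := fun f hf hfk => by
    simp [hc, hfk, huy f (by simp [hf]), hf]
  have hcB : ∀ f, s f = s(u, v₂) → c f = 1 := fun f hf => by
    have h3 : f ≠ k₁ := fun h3 => hv (Sym2.congr_right.1 ((h3 ▸ hsk₁).symm.trans hf))
    simp [hc, h3, huy f (by simp [hf]), hf, hu₁.symm, hv]
  refine h.false_of_credits (S := {f ∈ F | u ∈ s f ∨ f = y}) (filter_subset _ _)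
    ⟨y, by simp [hy]⟩ (W := {v₁, v₂}) ?_ c ?_
  · intro e he
    obtain ⟨heF, hue | rfl⟩ := mem_filter.1 he
    · rcases hedge e heF hue with h3 | h3
      · exact ⟨u, v₁, h3, by simp [hu₁, hu₂], by simp⟩
      · exact ⟨u, v₂, h3, by simp [hu₁, hu₂], by simp⟩
    · exact ⟨z, v₁, hsy.trans Sym2.eq_swap, by simp [hz₁.symm, hz₂], by simp⟩
  · intro e he
    obtain ⟨heF, hue | rfl⟩ := mem_filter.1 he
    · have hle := hldeg e heF hue
      rcases hedge e heF hue with h3 | h3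
      · by_cases hek : e = k₁
        · refine ⟨{y}, by simp [hy], by simpa using hle, fun f hf => ?_⟩
          rw [mem_singleton.1 hf]
          exact credit_right (h3.trans Sym2.eq_swap) hsy hzu.symm (by simp)
            (by rw [hek, hck₁, hcy]; omega)
        · refine ⟨{k₂}, by simp [hk₂, hsk₂], by simpa using hle, fun f hf => ?_⟩
          rw [mem_singleton.1 hf]
          exact credit_left h3 hsk₂ hv (by simp [hu₁, hu₂])
            (by rw [hcA e h3 hek, hcB k₂ hsk₂]; omega)
      · refine ⟨{k₁}, by simp [hk₁, hsk₁], by simpa using hle, fun f hf => ?_⟩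
        rw [mem_singleton.1 hf]
        exact credit_left h3 hsk₁ hv.symm (by simp [hu₁, hu₂]) (by rw [hcB e h3, hck₁]; omega)
    · refine ⟨{f ∈ F | s f = s(u, v₁)}.erase k₁, fun f hf => ?_, ?_, fun f hf => ?_⟩
      · have h3 := mem_filter.1 (mem_of_mem_erase hf)
        exact mem_filter.2 ⟨h3.1, Or.inl (by simp [h3.2])⟩
      · have := h.ldeg_le e heF
        omega
      · have h3 := mem_filter.1 (mem_of_mem_erase hf)
        exact credit_right hsy (h3.2.trans Sym2.eq_swap) hzu (by simp)
          (by rw [hcy, hcA f h3.2 (ne_of_mem_erase hf)]; omega)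

/-- With only two neighbors, u would have degree exactly 6 and carry two triples, since
multiplicities are at most 3 and degrees at least 6. -/
theorem exists_third (h : IsCritical s F k) {e : E} (he : e ∈ F) {u v₁ v₂ : V} (hue : u ∈ s e)
    (hu₁ : u ≠ v₁) (hu₂ : u ≠ v₂) (hv : v₁ ≠ v₂) :
    ∃ f ∈ F, ∃ w, s f = s(u, w) ∧ u ≠ w ∧ w ≠ v₁ ∧ w ≠ v₂ := by
  by_contra hcon
  push Not at hcon
  have hsub : {f ∈ F | u ∈ s f} ⊆ {f ∈ F | s f = s(u, v₁)} ∪ {f ∈ F | s f = s(u, v₂)} := by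
    intro f hf
    obtain ⟨hfF, hf⟩ := mem_filter.1 hf
    obtain ⟨w, huw, hw⟩ := h.exists_ends hfF hf
    simp only [mem_union, mem_filter]
    by_cases hw₁ : w = v₁
    · exact Or.inl ⟨hfF, hw₁ ▸ hw⟩
    · exact Or.inr ⟨hfF, hcon f hfF w hw huw hw₁ ▸ hw⟩
  have h1 : vdeg s F u ≤ mult s F s(u, v₁) + mult s F s(u, v₂) :=
    (card_le_card hsub).trans (card_union_le _ _)
  have h2 := h.mult_le_three u v₁
  have h3 := h.mult_le_three u v₂
  have h4 := h.six_le_vdeg he hue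
  exact h.false_of_triples_of_vdeg_eq_six hu₁ hu₂ hv (by omega) (by omega) (by omega)

/-- The edges uz and vz are adjacent. Pairing each with an edge from the opposite end of the triple
to a third neighbor gives the configuration of `false_of_pairs` with #K = 3. -/
theorem not_triangle (h : IsCritical s F k) {u v z : V} (huv : u ≠ v) (huz : u ≠ z) (hvz : v ≠ z)
    (hm : 3 ≤ mult s F s(u, v)) {a b' : E} (ha : a ∈ F) (hsa : s a = s(u, z)) (hb' : b' ∈ F)
    (hsb' : s b' = s(v, z)) : False := by
  obtain ⟨b, hb, w, hsb, huw, hwv, hwz⟩ := h.exists_third ha (by simp [hsa]) huv huz hvz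
  obtain ⟨a', ha', w', hsa', hvw', hwu', hwz'⟩ :=
    h.exists_third hb' (by simp [hsb']) huv.symm hvz huz
  have h3 := h.mult_le_three u v
  refine h.false_of_pairs (u := u) (v := v) (K := {f ∈ F | s f = s(u, v)}) (filter_subset _ _)
    (fun f hf => (mem_filter.1 hf).2) hm (h3.trans (by norm_num)) ha ha' hb hb' (by simp [hsa])
    (by simp [hsa, huv.symm, hvz]) (by simp [hsb]) (by simp [hsb, huv.symm, hwv.symm])
    (by simp [hsa']) (by simp [hsa', huv, hwu'.symm]) (by simp [hsb']) (by simp [hsb', huv, huz])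
    ?_ ?_ ?_ ?_ (Or.inr ⟨?_, z, by simp [hsa], by simp [hsb']⟩)
  · intro hab
    rw [hab, hsb] at hsa
    exact hwz (Sym2.congr_right.1 hsa)
  · intro hab
    rw [hab, hsb'] at hsa'
    exact hwz' (Sym2.congr_right.1 hsa').symm
  · rintro ⟨-, x, hx, hx'⟩
    rw [hsa, Sym2.mem_iff] at hx
    rw [hsa', Sym2.mem_iff] at hx'
    rcases hx with rfl | rfl <;> rcases hx' with hx' | hx'
    exacts [huv hx', hwu' hx'.symm, hvz hx'.symm, hwz' hx'.symm]
  · rintro ⟨-, x, hx, hx'⟩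
    rw [hsb, Sym2.mem_iff] at hx
    rw [hsb', Sym2.mem_iff] at hx'
    rcases hx with rfl | rfl <;> rcases hx' with hx' | hx'
    exacts [huv hx', huz hx', hwv hx', hwz hx']
  · intro hab
    rw [hab, hsb'] at hsa
    rcases Sym2.eq_iff.1 hsa with ⟨h1, -⟩ | ⟨h1, -⟩
    exacts [huv h1.symm, hvz h1]

theorem card_filter_not_mem (h : IsCritical s F k) {u v : V} (huv : u ≠ v) :
    vdeg s F v ≤ #{f ∈ F | v ∈ s f ∧ u ∉ s f} + 3 := by
  have hsub : {f ∈ F | v ∈ s f} ⊆ {f ∈ F | v ∈ s f ∧ u ∉ s f} ∪ {f ∈ F | s f = s(u, v)} := by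
    intro f hf
    obtain ⟨hfF, hf⟩ := mem_filter.1 hf
    simp only [mem_union, mem_filter]
    by_cases huf : u ∈ s f
    · exact Or.inr ⟨hfF, (Sym2.mem_and_mem_iff huv).1 ⟨huf, hf⟩⟩
    · exact Or.inl ⟨hfF, hf, huf⟩
  have h1 := (card_le_card hsub).trans (card_union_le _ _)
  have h2 := h.mult_le_three u v
  simp only [vdeg, mult] at h1 h2 ⊢
  omega

theorem false_of_triples (h : IsCritical s F k) {u v₁ v₂ : V} (hu₁ : u ≠ v₁)
    (hu₂ : u ≠ v₂) (hv : v₁ ≠ v₂) (h₁ : 3 ≤ mult s F s(u, v₁)) (h₂ : 3 ≤ mult s F s(u, v₂)) :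
    False := by
  obtain ⟨k₁, hk₁, hsk₁, hcard₁⟩ := exists_of_le_mult h₁
  obtain ⟨k₂, hk₂, hsk₂, hcard₂⟩ := exists_of_le_mult h₂
  obtain ⟨g, hg, w, hsg, huw, hw₁, hw₂⟩ := h.exists_third hk₁ (by simp [hsk₁]) hu₁ hu₂ hv
  set Y₁ := {f ∈ F | v₁ ∈ s f ∧ u ∉ s f} with hY₁
  have hYcard₁ : 3 ≤ #Y₁ := by
    have : vdeg s F v₁ ≤ #Y₁ + 3 := h.card_filter_not_mem hu₁
    have := h.six_le_vdeg hk₁ (x := v₁) (by simp [hsk₁])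
    omega
  obtain ⟨y, hy⟩ : ({f ∈ F | v₂ ∈ s f ∧ u ∉ s f}).Nonempty := card_pos.1 (by
    have := h.card_filter_not_mem hu₂
    have := h.six_le_vdeg hk₂ (x := v₂) (by simp [hsk₂])
    omega)
  obtain ⟨hyF, hyv, hyu⟩ := mem_filter.1 hy
  have hend₁ : ∀ f ∈ F, v₁ ∈ s f → u ∉ s f → ∃ z, s f = s(v₁, z) ∧ z ≠ u ∧ z ≠ v₁ ∧ z ≠ v₂ ∧ z ≠ w := by
    intro f hf hvf huf
    obtain ⟨z, hz, hsf⟩ := h.exists_ends hf hvf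
    refine ⟨z, hsf, fun h3 => huf (by simp [hsf, h3]), hz.symm, fun h3 => ?_, fun h3 => ?_⟩
    · exact h.not_triangle hu₁ hu₂ hv h₁ hk₂ hsk₂ hf (h3 ▸ hsf)
    · exact h.not_triangle hu₁ huw hw₁.symm h₁ hg hsg hf (h3 ▸ hsf)
  have hend₂ : ∀ f ∈ F, v₂ ∈ s f → u ∉ s f → ∃ z, s f = s(v₂, z) ∧ z ≠ u ∧ z ≠ v₁ ∧ z ≠ v₂ ∧ z ≠ w := by
    intro f hf hvf huf
    obtain ⟨z, hz, hsf⟩ := h.exists_ends hf hvf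
    refine ⟨z, hsf, fun h3 => huf (by simp [hsf, h3]), fun h3 => ?_, hz.symm, fun h3 => ?_⟩
    · exact h.not_triangle hu₂ hu₁ hv.symm h₂ hk₁ hsk₁ hf (h3 ▸ hsf)
    · exact h.not_triangle hu₂ huw hw₂.symm h₂ hg hsg hf (h3 ▸ hsf)
  have hwit : ∀ f, u ∉ s f → f ≠ k₁ ∧ f ≠ k₂ ∧ f ≠ g := fun f hf =>
    ⟨fun h3 => hf (by simp [h3, hsk₁]), fun h3 => hf (by simp [h3, hsk₂]),
      fun h3 => hf (by simp [h3, hsg])⟩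
  have hk₁₂ : k₂ ≠ k₁ := fun h3 => hv (Sym2.congr_right.1 ((h3 ▸ hsk₁).symm.trans hsk₂))
  have hgk₁ : g ≠ k₁ := fun h3 => hw₁ (Sym2.congr_right.1 (hsg.symm.trans (h3 ▸ hsk₁)))
  have hgk₂ : g ≠ k₂ := fun h3 => hw₂ (Sym2.congr_right.1 (hsg.symm.trans (h3 ▸ hsk₂)))
  -- Every edge gets two credits. At u, the remaining triple edges and g are preferred to two of k₁,
  -- k₂, g. At v₁ and v₂, the edges avoiding u are preferred to the two remaining triple edges.
  -- Finally, k₁ is preferred to all of Y₁, and k₂ to k₁ at u and to y at v₂.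
  set c : E → ℕ := fun f => if f = k₁ then 0 else if f = k₂ then 1 else if f = g then 2 else
    if u ∈ s f then (if v₁ ∈ s f then 4 else 6) else if v₁ ∈ s f then 3 else 5 with hc
  have hck₁ : c k₁ = 0 := by simp [hc]
  have hck₂ : c k₂ = 1 := by simp [hc, hk₁₂]
  have hcg : c g = 2 := by simp [hc, hgk₁, hgk₂]
  have hcA : ∀ f, s f = s(u, v₁) → f ≠ k₁ → c f = 4 := fun f hf hfk => by
    have h3 : f ≠ k₂ := fun h3 => hv (Sym2.congr_right.1 (hf.symm.trans (h3 ▸ hsk₂)))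
    have h4 : f ≠ g := fun h3 => hw₁ (Sym2.congr_right.1 (hf.symm.trans (h3 ▸ hsg))).symm
    simp [hc, hfk, h3, h4, hf]
  have hcB : ∀ f, s f = s(u, v₂) → f ≠ k₂ → c f = 6 := fun f hf hfk => by
    have h3 : f ≠ k₁ := fun h3 => hv (Sym2.congr_right.1 (hf.symm.trans (h3 ▸ hsk₁))).symm
    have h4 : f ≠ g := fun h3 => hw₂ (Sym2.congr_right.1 (hf.symm.trans (h3 ▸ hsg))).symm
    simp [hc, hfk, h3, h4, hf, hu₁.symm, hv]
  have hcY₁ : ∀ f, v₁ ∈ s f → u ∉ s f → c f = 3 := fun f hf huf => by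
    simp [hc, hwit f huf, hf, huf]
  have hcY₂ : ∀ f, v₁ ∉ s f → u ∉ s f → c f = 5 := fun f hf huf => by
    simp [hc, hwit f huf, hf, huf]
  set S := {f ∈ F | v₁ ∈ s f ∨ v₂ ∈ s f ∨ f = g} with hS
  have hk₁S : k₁ ∈ S := mem_filter.2 ⟨hk₁, by simp [hsk₁]⟩
  have hk₂S : k₂ ∈ S := mem_filter.2 ⟨hk₂, by simp [hsk₂]⟩
  have hgS : g ∈ S := mem_filter.2 ⟨hg, by simp⟩
  have hyS : y ∈ S := mem_filter.2 ⟨hyF, by simp [hyv]⟩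
  have hcases : ∀ f ∈ S, f = g ∨ s f = s(u, v₁) ∨ s f = s(u, v₂) ∨ (v₁ ∈ s f ∧ u ∉ s f) ∨
      (v₂ ∈ s f ∧ u ∉ s f) := by
    intro f hf
    obtain ⟨-, hf⟩ := mem_filter.1 hf
    by_cases huf : u ∈ s f
    · rcases hf with hf | hf | hf
      · exact Or.inr (Or.inl ((Sym2.mem_and_mem_iff hu₁).1 ⟨huf, hf⟩))
      · exact Or.inr (Or.inr (Or.inl ((Sym2.mem_and_mem_iff hu₂).1 ⟨huf, hf⟩)))
      · exact Or.inl hf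
    · tauto
  -- By `not_triangle`, no edge of S joins two of these vertices, so S is bipartite.
  set W : Set V := {v₁, v₂, w} with hW
  have huW : u ∉ W := by simp [hW, hu₁, hu₂, huw]
  have hv₁W : v₁ ∈ W := by simp [hW]
  have hv₂W : v₂ ∈ W := by simp [hW]
  refine h.false_of_credits (S := S) (filter_subset _ _) ⟨g, hgS⟩ (W := W) ?_ c ?_
  · intro e he
    have heF := (mem_filter.1 he).1
    rcases hcases e he with rfl | h3 | h3 | ⟨h3, h4⟩ | ⟨h3, h4⟩
    · exact ⟨u, w, hsg, huW, by simp [hW]⟩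
    · exact ⟨u, v₁, h3, huW, hv₁W⟩
    · exact ⟨u, v₂, h3, huW, hv₂W⟩
    · obtain ⟨z, hz, -, hz₁, hz₂, hz₃⟩ := hend₁ e heF h3 h4
      exact ⟨z, v₁, hz.trans Sym2.eq_swap, by simp [hW, hz₁, hz₂, hz₃], hv₁W⟩
    · obtain ⟨z, hz, -, hz₁, hz₂, hz₃⟩ := hend₂ e heF h3 h4
      exact ⟨z, v₂, hz.trans Sym2.eq_swap, by simp [hW, hz₁, hz₂, hz₃], hv₂W⟩
  · intro e he
    have heF := (mem_filter.1 he).1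
    have hle := h.ldeg_le e heF
    have hpair : ∀ {f f' : E}, f ≠ f' → ldeg s F e + 1 ≤ k + #{f, f'} := fun hff => by
      rw [card_pair hff]; omega
    have hclass : ∀ (a : Sym2 V) (f : E), (a = s(u, v₁) ∨ a = s(u, v₂)) →
        {f ∈ F | s f = a}.erase f ⊆ S := by
      intro a f ha e' he'
      have h3 := mem_filter.1 (mem_of_mem_erase he')
      refine mem_filter.2 ⟨h3.1, ?_⟩
      rcases ha with ha | ha <;> simp [h3.2, ha]
    rcases hcases e he with rfl | h3 | h3 | ⟨h3, h4⟩ | ⟨h3, h4⟩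
    · refine ⟨{k₁, k₂}, by simp [insert_subset_iff, hk₁S, hk₂S], hpair hk₁₂.symm, fun f hf => ?_⟩
      rcases mem_insert.1 hf with rfl | hf
      · exact credit_left hsg hsk₁ hw₁ huW (by omega)
      · rw [mem_singleton.1 hf]
        exact credit_left hsg hsk₂ hw₂ huW (by omega)
    · by_cases hek : e = k₁
      · refine ⟨Y₁, fun f hf => ?_, by omega, fun f hf => ?_⟩
        · have h4 := mem_filter.1 hf
          exact mem_filter.2 ⟨h4.1, Or.inl h4.2.1⟩
        · obtain ⟨hfF, h4, h5⟩ := mem_filter.1 hf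
          obtain ⟨z, hz, hzu, -⟩ := hend₁ f hfF h4 h5
          exact credit_right (h3.trans Sym2.eq_swap) hz hzu.symm hv₁W
            (by rw [hek, hck₁, hcY₁ f h4 h5]; omega)
      · have hce := hcA e h3 hek
        refine ⟨{k₂, g}, by simp [insert_subset_iff, hgS, hk₂S], hpair hgk₂.symm, fun f hf => ?_⟩
        rcases mem_insert.1 hf with rfl | hf
        · exact credit_left h3 hsk₂ hv huW (by omega)
        · rw [mem_singleton.1 hf]
          exact credit_left h3 hsg hw₁.symm huW (by omega)
    · by_cases hek : e = k₂
      · have hyk : k₁ ≠ y := (hwit y hyu).1.symm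
        obtain ⟨z, hz, hzu, hz₁, -⟩ := hend₂ y hyF hyv hyu
        have hcy := hcY₂ y (by simp [hz, hz₁.symm, hv]) hyu
        refine ⟨{k₁, y}, by simp [insert_subset_iff, hk₁S, hyS], hpair hyk, fun f hf => ?_⟩
        rcases mem_insert.1 hf with rfl | hf
        · exact credit_left h3 hsk₁ hv.symm huW (by rw [hek]; omega)
        · rw [mem_singleton.1 hf]
          exact credit_right (h3.trans Sym2.eq_swap) hz hzu.symm hv₂W (by rw [hek]; omega)
      · have hce := hcB e h3 hek
        refine ⟨{k₁, g}, by simp [insert_subset_iff, hgS, hk₁S], hpair hgk₁.symm, fun f hf => ?_⟩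
        rcases mem_insert.1 hf with rfl | hf
        · exact credit_left h3 hsk₁ hv.symm huW (by omega)
        · rw [mem_singleton.1 hf]
          exact credit_left h3 hsg hw₂.symm huW (by omega)
    · obtain ⟨z, hz, hzu, -⟩ := hend₁ e heF h3 h4
      refine ⟨_, hclass _ k₁ (Or.inl rfl), by omega, fun f hf => ?_⟩
      have h5 := (mem_filter.1 (mem_of_mem_erase hf)).2
      exact credit_right hz (h5.trans Sym2.eq_swap) hzu hv₁W
        (by rw [hcY₁ e h3 h4, hcA f h5 (ne_of_mem_erase hf)]; omega)
    · obtain ⟨z, hz, hzu, hz₁, -⟩ := hend₂ e heF h3 h4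
      refine ⟨_, hclass _ k₂ (Or.inr rfl), by omega, fun f hf => ?_⟩
      have h5 := (mem_filter.1 (mem_of_mem_erase hf)).2
      exact credit_right hz (h5.trans Sym2.eq_swap) hzu hv₂W
        (by rw [hcY₂ e (by simp [hz, hz₁.symm, hv]) h4, hcB f h5 (ne_of_mem_erase hf)]; omega)

theorem ldeg_le_of_vdeg_le_seven (h : IsCritical s F k) {e : E} (he : e ∈ F) {u v : V}
    (hs : s e = s(u, v)) (huv : u ≠ v) (hm : 3 ≤ mult s F s(u, v)) (hd : vdeg s F u ≤ 7) :
    ldeg s F e ≤ k := by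
  by_contra hlt
  have h1 := h.ldeg_le e he
  have h2 := h.le_vdeg e he u (by simp [hs])
  have h3 := ldeg_add_mult he hs huv
  have h4 := h.mult_le_three u v
  obtain ⟨f, hf⟩ : ({f ∈ F | v ∈ s f ∧ u ∉ s f}).Nonempty := card_pos.1 (by
    have := h.card_filter_not_mem huv
    have := h.six_le_vdeg he (x := v) (by simp [hs])
    omega)
  obtain ⟨hfF, hvf, huf⟩ := mem_filter.1 hf
  obtain ⟨w, hvw, hsf⟩ := h.exists_ends hfF hvf
  have h5 := ldeg_add_mult hfF hsf hvw
  have h6 := h.le_vdeg f hfF w (by simp [hsf])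
  -- The degree of u is 7, so v has degree k - 2. The degree condition at w then forces multiplicity
  -- at least 3 for vw, a second triple at v.
  exact h.false_of_triples huv.symm hvw (fun h7 => huf (by simp [hsf, h7]))
    (by rwa [Sym2.eq_swap]) (v₂ := w) (by omega)

end IsCritical
end Triples

/-! ### A weighted maximum cut and the final contradiction -/

section Cut
open scoped Classical
open Finset

variable {V E : Type*} {s : E → Sym2 V} {F : Finset E} {k : ℕ}

/-- The edge `e` joins a vertex outside `W` to a vertex in `W`. -/
def Crosses (s : E → Sym2 V) (W : Set V) (e : E) : Prop :=
  ∃ x y, s e = s(x, y) ∧ x ∉ W ∧ y ∈ W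

theorem crosses_iff {W : Set V} {e : E} {a b : V} (hs : s e = s(a, b)) :
    Crosses s W e ↔ (a ∈ W ↔ b ∉ W) := by
  constructor
  · rintro ⟨x, y, hxy, hx, hy⟩
    rw [hs, Sym2.eq_iff] at hxy
    rcases hxy with ⟨rfl, rfl⟩ | ⟨rfl, rfl⟩ <;> tauto
  · intro h
    by_cases ha : a ∈ W
    · exact ⟨b, a, hs.trans Sym2.eq_swap, h.1 ha, ha⟩
    · exact ⟨a, b, hs, ha, by tauto⟩

theorem exists_max_cut (hF : ∀ e ∈ F, ¬ (s e).IsDiag) (w : E → ℕ) :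
    ∃ W : Set V, ∀ x, ∑ e ∈ F with x ∈ s e ∧ ¬ Crosses s W e, w e ≤
      ∑ e ∈ F with x ∈ s e ∧ Crosses s W e, w e := by
  set val : Set V → ℕ := fun W => ∑ e ∈ F with Crosses s W e, w e with hval
  have hbdd : BddAbove (Set.range val) := ⟨∑ e ∈ F, w e, by
    rintro _ ⟨W, rfl⟩
    exact sum_le_sum_of_subset (filter_subset _ _)⟩
  obtain ⟨W, hW⟩ := Nat.sSup_mem (Set.range_nonempty val) hbdd
  refine ⟨W, fun x => ?_⟩
  -- Moving x to the other side exchanges the crossing and noncrossing edges at x and changes no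
  -- others.
  obtain ⟨W', hW'⟩ : ∃ W' : Set V, ∀ y, y ∈ W' ↔ (y ∈ W ↔ y ≠ x) :=
    ⟨{y | y ∈ W ↔ y ≠ x}, fun _ => Iff.rfl⟩
  have hmax : val W' ≤ val W := by
    rw [hW]
    exact le_csSup hbdd ⟨_, rfl⟩
  have hsplit : ∀ W', val W' = ∑ e ∈ F with x ∈ s e ∧ Crosses s W' e, w e +
      ∑ e ∈ F with x ∉ s e ∧ Crosses s W' e, w e := by
    intro W'
    rw [hval]
    simp only
    rw [← sum_filter_add_sum_filter_not {e ∈ F | Crosses s W' e} fun e => x ∈ s e,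
      filter_filter, filter_filter]
    simp only [and_comm]
  rw [hsplit, hsplit W] at hmax
  have h1 : {e ∈ F | x ∈ s e ∧ Crosses s W' e} =
      {e ∈ F | x ∈ s e ∧ ¬ Crosses s W e} := by
    refine filter_congr fun e he => and_congr_right fun hx => ?_
    obtain ⟨y, hy⟩ := Sym2.mem_iff_exists.1 hx
    have hxy : y ≠ x := fun hyx => hF e he (by rw [hy, hyx]; exact Sym2.mk_isDiag_iff.2 rfl)
    rw [crosses_iff hy, crosses_iff hy]
    simp only [hW', hxy, ne_eq, not_true_eq_false, not_false_eq_true, iff_true, iff_false]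
    tauto
  have h2 : {e ∈ F | x ∉ s e ∧ Crosses s W' e} =
      {e ∈ F | x ∉ s e ∧ Crosses s W e} := by
    refine filter_congr fun e he => and_congr_right fun hx => ?_
    obtain ⟨b, hab⟩ := Sym2.mem_iff_exists.1 (Sym2.out_fst_mem (s e))
    set a := (s e).out.1
    rw [hab, Sym2.mem_iff, not_or] at hx
    rw [crosses_iff hab, crosses_iff hab]
    simp only [hW', Ne.symm hx.1, Ne.symm hx.2, ne_eq, not_false_eq_true, iff_true]
  rw [h1, h2] at hmax
  omega

namespace IsCritical

/-- The weight of an edge in the maximum cut: edges of multiplicity three count slightly less. -/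
noncomputable def cutWeight (s : E → Sym2 V) (F : Finset E) (e : E) : ℕ :=
  if 3 ≤ mult s F (s e) then 3 else 4

theorem sum_cutWeight (T : Finset E) :
    ∑ e ∈ T, cutWeight s F e + #{e ∈ T | 3 ≤ mult s F (s e)} = 4 * #T := by
  rw [card_filter, ← sum_add_distrib, mul_comm, ← smul_eq_mul, ← sum_const]
  refine sum_congr rfl fun e _ => ?_
  unfold cutWeight
  split_ifs <;> rfl

theorem eq_of_three_le_mult (h : IsCritical s F k) {e f : E} (he : e ∈ F) (hf : f ∈ F) {x : V}
    (hxe : x ∈ s e) (hxf : x ∈ s f) (hme : 3 ≤ mult s F (s e)) (hmf : 3 ≤ mult s F (s f)) :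
    s e = s f := by
  obtain ⟨y, hy, hse⟩ := h.exists_ends he hxe
  obtain ⟨z, hz, hsf⟩ := h.exists_ends hf hxf
  by_contra hne
  exact h.false_of_triples hy hz (fun hyz => hne (by rw [hse, hsf, hyz])) (hse ▸ hme) (hsf ▸ hmf)

/-- At most three edges at x lie in triples, all parallel, so reducing their weights from 4 to 3
cannot upset an integral majority. If these edges cross, the reduction falls only on the crossing
side, and the majority is strict. -/
theorem exists_cut (h : IsCritical s F k) :
    ∃ W : Set V, ∀ x, vdeg s F x ≤ 2 * vdeg s {e ∈ F | Crosses s W e} x ∧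
      ∀ e ∈ F, Crosses s W e → x ∈ s e → 3 ≤ mult s F (s e) →
        vdeg s F x < 2 * vdeg s {e ∈ F | Crosses s W e} x := by
  obtain ⟨W, hW⟩ := exists_max_cut h.not_isDiag (cutWeight s F)
  refine ⟨W, fun x => ?_⟩
  have hx := hW x
  have h1 := sum_cutWeight (s := s) (F := F) {e ∈ F | x ∈ s e ∧ Crosses s W e}
  have h2 := sum_cutWeight (s := s) (F := F) {e ∈ F | x ∈ s e ∧ ¬ Crosses s W e}
  have h3 : vdeg s F x = #{e ∈ F | x ∈ s e ∧ Crosses s W e} +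
      #{e ∈ F | x ∈ s e ∧ ¬ Crosses s W e} := by
    rw [vdeg, ← card_filter_add_card_filter_not fun e => Crosses s W e, filter_filter,
      filter_filter]
  have h4 : vdeg s {e ∈ F | Crosses s W e} x = #{e ∈ F | x ∈ s e ∧ Crosses s W e} := by
    rw [vdeg, filter_filter]
    simp only [and_comm]
  have h5 : #{e ∈ {e ∈ F | x ∈ s e ∧ ¬ Crosses s W e} | 3 ≤ mult s F (s e)} ≤ 3 := by
    rcases {e ∈ {e ∈ F | x ∈ s e ∧ ¬ Crosses s W e} | 3 ≤ mult s F (s e)}.eq_empty_or_nonempty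
      with h6 | ⟨e, he⟩
    · simp [h6]
    · simp only [mem_filter] at he
      obtain ⟨⟨heF, hxe, -⟩, hme⟩ := he
      obtain ⟨y, -, hse⟩ := h.exists_ends heF hxe
      refine (card_le_card (t := {f ∈ F | s f = s(x, y)}) fun f hf => ?_).trans
        (h.mult_le_three x y)
      simp only [mem_filter] at hf ⊢
      exact ⟨hf.1.1, by rw [← hse]; exact h.eq_of_three_le_mult hf.1.1 heF hf.1.2.1 hxe hf.2 hme⟩
  refine ⟨by omega, fun e he hcr hxe hme => ?_⟩
  have h6 : 0 < #{e ∈ {e ∈ F | x ∈ s e ∧ Crosses s W e} | 3 ≤ mult s F (s e)} :=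
    card_pos.2 ⟨e, by simp [he, hcr, hxe, hme]⟩
  have h7 : #{e ∈ {e ∈ F | x ∈ s e ∧ ¬ Crosses s W e} | 3 ≤ mult s F (s e)} = 0 := by
    rw [card_eq_zero, filter_eq_empty_iff]
    intro f hf hmf
    simp only [mem_filter] at hf
    obtain ⟨a, b, hab, ha, hb⟩ := hcr
    exact hf.2.2 ⟨a, b, (h.eq_of_three_le_mult hf.1 he hf.2.1 hxe hmf hme).trans hab, ha, hb⟩
  omega

theorem eq_empty (h : IsCritical s F k) : F = ∅ := by
  by_contra hne
  obtain ⟨e₀, he₀⟩ := nonempty_iff_ne_empty.2 hne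
  obtain ⟨W, hW⟩ := h.exists_cut
  set S := {e ∈ F | Crosses s W e} with hS
  have hSF : S ⊆ F := filter_subset _ _
  have hSne : S.Nonempty := by
    have h1 := (hW (s e₀).out.1).1
    have h2 := h.six_le_vdeg he₀ (Sym2.out_fst_mem _)
    have h3 : 0 < vdeg s S (s e₀).out.1 := by omega
    exact (card_pos.1 h3).mono (filter_subset _ _)
  obtain ⟨l, r, hlr⟩ := exists_left_right hSne (W := W) fun e he => (mem_filter.1 he).2
  obtain ⟨c, hc, hcard⟩ := exists_proper_card_beats_lt l r S
  have hbip : ∀ e ∈ S, ∀ f ∈ S, l e ≠ r f := fun e he f hf hef =>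
    (hlr e he).2.1 (hef ▸ (hlr f hf).2.2)
  refine h.false_of_beats hSF hSne (fun e he => (hlr e he).1) hbip hc fun e he => ?_
  have heF := hSF he
  have hl : #{f ∈ S | l f = l e} = vdeg s S (l e) := by
    refine congrArg card (filter_congr fun f hf => ?_)
    rw [(hlr f hf).1, Sym2.mem_iff]
    exact ⟨fun h => Or.inl h.symm, fun h => h.elim Eq.symm fun h => absurd h (hbip e he f hf)⟩
  have hr : #{f ∈ S | r f = r e} = vdeg s S (r e) := by
    refine congrArg card (filter_congr fun f hf => ?_)
    rw [(hlr f hf).1, Sym2.mem_iff]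
    exact ⟨fun h => Or.inr h.symm,
      fun h => h.elim (fun h => absurd h.symm (hbip f hf e he)) Eq.symm⟩
  have hs := (hlr e he).1
  have hne : l e ≠ r e := hbip e he e he
  have hmult : mult s S s(l e, r e) = mult s F s(l e, r e) := by
    refine congrArg card ?_
    rw [hS, filter_filter]
    refine filter_congr fun f _ => and_iff_right_of_imp fun hf => ?_
    exact ⟨l e, r e, hf, (hlr e he).2⟩
  have h1 := ldeg_add_mult heF hs hne
  have h2 := ldeg_add_mult he hs hne
  have h3 := h.mult_le_three (l e) (r e)
  have h4 := h.le_ldeg heF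
  have h5 := h.ldeg_le e heF
  -- Applied at both ends and combined with `ldeg_add_mult` in F and in S, this is the list size
  -- needed for the larger of the two degrees.
  have key : ∀ x y, s e = s(x, y) → x ≠ y →
      ldeg s F e + mult s F s(x, y) + 1 ≤ k + vdeg s S x := by
    intro x y hxy hxyne
    have hx : x ∈ s e := by simp [hxy]
    have g1 := h.le_vdeg e heF x hx
    have g2 := (hW x).1
    have g3 := h.mult_le_three x y
    by_cases hm : 3 ≤ mult s F s(x, y)
    · have g4 := (hW x).2 e heF (mem_filter.1 he).2 hx (hxy ▸ hm)
      have g5 : 7 < vdeg s F x ∨ ldeg s F e ≤ k := by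
        by_cases hd : vdeg s F x ≤ 7
        · exact Or.inr (h.ldeg_le_of_vdeg_le_seven heF hxy hxyne hm hd)
        · exact Or.inl (not_le.1 hd)
      omega
    · omega
  have h6 := key (l e) (r e) hs hne
  have h7 := key (r e) (l e) (hs.trans Sym2.eq_swap) hne.symm
  rw [Sym2.eq_swap (a := r e)] at h7
  have h8 := hcard e he
  rw [hl, hr] at h8
  omega

end IsCritical
end Cut

/-! ### From a minimal uncolorable edge set to a critical one -/

section Transfer
open scoped Classical
open Finset

variable {V E : Type*}

/-- Color F \ S by minimality and delete from each list on S the colors of its neighbors outside S.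
A coloring of S from these lists would extend to F. -/
theorem exists_lists_of_minimal {s : E → Sym2 V} {F : Finset E} {L : E → Finset ℕ} {k : ℕ}
    (hL : ∀ e ∈ F, #(L e) = k) (hF : Minimal (fun F => ¬ ListColorable s F L) F) :
    ∀ S ⊆ F, S.Nonempty → ∃ L' : E → Finset ℕ,
      (∀ e ∈ S, k + ldeg s S e ≤ #(L' e) + ldeg s F e) ∧ ¬ ListColorable s S L' := by
  intro S hSF hS
  have hcol : ListColorable s (F \ S) L := by
    by_contra hcol
    exact (sdiff_ssubset hSF hS).not_subset (hF.le_of_le hcol sdiff_subset)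
  obtain ⟨φ, hφL, hφ⟩ := hcol
  refine ⟨fun e => L e \ {f ∈ F \ S | LAdj s e f}.image φ, fun e he => ?_, ?_⟩
  · have h1 := le_card_sdiff ({f ∈ F \ S | LAdj s e f}.image φ) (L e)
    have h2 := card_image_le (s := {f ∈ F \ S | LAdj s e f}) (f := φ)
    have h3 : ldeg s F e = ldeg s S e + #{f ∈ F \ S | LAdj s e f} := by
      rw [ldeg, ldeg, ← card_union_of_disjoint, ← filter_union, union_sdiff_of_subset hSF]
      exact disjoint_filter_filter disjoint_sdiff
    have h4 := hL e (hSF he)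
    beta_reduce
    omega
  · rintro ⟨ψ, hψL, hψ⟩
    refine hF.prop ⟨fun e => if e ∈ S then ψ e else φ e, fun e he => ?_, fun e he f hf hef => ?_⟩
    · by_cases heS : e ∈ S
      · simpa [heS] using (mem_sdiff.1 (hψL e heS)).1
      · simpa [heS] using hφL e (mem_sdiff.2 ⟨he, heS⟩)
    · have hcross : ∀ e ∈ S, ∀ f ∈ F \ S, LAdj s e f → ψ e ≠ φ f := fun e he f hf hef heq =>
        (mem_sdiff.1 (hψL e he)).2 (heq ▸ mem_image_of_mem φ (mem_filter.2 ⟨hf, hef⟩))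
      by_cases heS : e ∈ S <;> by_cases hfS : f ∈ S
      · simpa [heS, hfS] using hψ e heS f hfS hef
      · simpa [heS, hfS] using hcross e heS f (mem_sdiff.2 ⟨hf, hfS⟩) hef
      · simpa [heS, hfS] using (hcross f hfS e (mem_sdiff.2 ⟨he, heS⟩) hef.symm).symm
      · simpa [heS, hfS] using hφ e (mem_sdiff.2 ⟨he, heS⟩) f (mem_sdiff.2 ⟨hf, hfS⟩) hef

end Transfer
end LineChoosability

/-! ### The theorem for multigraphs, and the tripled 5-cycle -/

namespace Graph
open LineChoosability Finset

theorem isChoosable_lineGraph {α β : Type*} (H : Graph α β) [Fintype E(H)] [H.Loopless]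
    [DecidableRel H.lineGraph.Adj] (hH : 7 ≤ H.minDegree) :
    H.lineGraph.IsChoosable fun _ => max H.lineGraph.cliqueNum (H.lineGraph.maxDegree - 1) := by
  classical
  set k := max H.lineGraph.cliqueNum (H.lineGraph.maxDegree - 1) with hk
  have hends : ∀ e : E(H), ∃ x y, H.IsLink e x y := fun e => H.exists_isLink_of_mem_edgeSet e.2
  choose a b hab using hends
  set s : E(H) → Sym2 α := fun e => s(a e, b e) with hs
  have hinc : ∀ (e : E(H)) x, H.Inc e x ↔ x ∈ s e := by
    intro e x
    rw [hs, Sym2.mem_iff]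
    constructor
    · exact fun h => h.eq_or_eq_of_isLink (hab e)
    · rintro (rfl | rfl)
      · exact (hab e).inc_left
      · exact (hab e).inc_right
  have hadj : ∀ e f, H.lineGraph.Adj e f ↔ LAdj s e f := by
    intro e f
    simp only [lineGraph, LAdj, hinc]
  have hdiag : ∀ e, ¬ (s e).IsDiag := by
    intro e he
    have hab' : a e = b e := Sym2.mk_isDiag_iff.1 he
    have := hab e
    rw [hab'] at this
    exact H.not_isLoopAt _ _ this
  have hdeg : ∀ e x, x ∈ s e → 7 ≤ vdeg s univ x := by
    intro e x hx
    have hxV : x ∈ V(H) := ((hinc e x).2 hx).vertex_mem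
    have h1 : 7 ≤ H.degree x := hH.trans (iInf₂_le x hxV)
    have h2 : H.loopSet x = ∅ := Set.eq_empty_of_forall_notMem fun f hf => H.not_isLoopAt f x hf
    have h3 : H.incidenceSet x = Subtype.val '' (({e | x ∈ s e} : Finset E(H)) : Set E(H)) := by
      ext f
      simp only [mem_incidenceSet, Set.mem_image, mem_coe, mem_filter, mem_univ, true_and]
      constructor
      · exact fun hf => ⟨⟨f, hf.edge_mem⟩, (hinc ⟨f, hf.edge_mem⟩ x).1 hf, rfl⟩
      · rintro ⟨f, hf, rfl⟩
        exact (hinc f x).2 hf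
    rw [degree, h2, h3, Set.encard_empty, add_zero, Subtype.val_injective.encard_image,
      Set.encard_coe_eq_coe_finsetCard] at h1
    have h4 : 7 ≤ #{e | x ∈ s e} := by exact_mod_cast h1
    convert h4 using 1
    unfold vdeg
    congr
  have hldeg : ∀ e, ldeg s univ e ≤ k + 1 := by
    intro e
    have h1 := H.lineGraph.degree_le_maxDegree e
    have h2 : ldeg s univ e = H.lineGraph.degree e := by
      rw [ldeg, ← SimpleGraph.card_neighborFinset_eq_degree]
      congr 1
      ext f
      simp [hadj]
    omega
  intro L hL
  by_contra hbad
  obtain ⟨F, hF⟩ : ∃ F, Minimal (fun F => ¬ ListColorable s F L) F :=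
    exists_minimal_of_wellFoundedLT _ ⟨univ, fun ⟨φ, h1, h2⟩ => hbad ⟨φ, fun e => h1 e (mem_univ e),
      fun e f hef => h2 e (mem_univ e) f (mem_univ f) ((hadj e f).1 hef)⟩⟩
  have hcrit : IsCritical s F k :=
    { not_isDiag := fun e _ => hdiag e
      exists_lists := exists_lists_of_minimal (fun e _ => hL e) hF
      ldeg_le := fun e _ => le_trans
        (card_le_card (filter_subset_filter _ (subset_univ F))) (hldeg e)
      card_clique_le := fun Q _ hQ => le_trans (SimpleGraph.IsClique.card_le_cliqueNum
        (tc := fun e he f hf hef => (hadj e f).2 (hQ e he f hf hef))) (le_max_left _ _)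
      -- Each edge at x outside F lowers both the degree of x and the line degree of e, so the
      -- comparison between 7 and k + 1 in the whole graph passes to F.
      le_vdeg := fun e he x hx => by
        have h1 := hldeg e
        have h2 := hdeg e x hx
        have h3 : vdeg s univ x ≤ vdeg s F x + #{f ∈ univ \ F | x ∈ s f} := by
          refine (card_le_card fun f hf => ?_).trans (card_union_le _ _)
          simp only [mem_union, mem_filter, mem_sdiff, mem_univ, true_and] at hf ⊢
          tauto
        have h4 : ldeg s F e + #{f ∈ univ \ F | x ∈ s f} ≤ ldeg s univ e := by
          rw [ldeg, ← card_union_of_disjoint]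
          · refine card_le_ldeg (subset_univ _) fun f hf => ?_
            simp only [mem_union, mem_filter, mem_sdiff, mem_univ, true_and] at hf
            rcases hf with hf | hf
            · exact hf.2
            · exact ⟨fun hef => hf.1 (hef ▸ he), x, hx, hf.2⟩
          · exact disjoint_filter_filter disjoint_sdiff
        omega }
  refine hF.prop ?_
  rw [hcrit.eq_empty]
  exact ⟨fun _ => 0, by simp, by simp⟩

theorem tripledFiveCycle_loopless : tripledFiveCycle.Loopless where
  not_isLoopAt e x h := by
    have h1 : s(x, x) = s(e.1, e.1 + 1) := h
    have h2 : ∀ i x : Fin 5, s(x, x) ≠ s(i, i + 1) := by decide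
    exact h2 e.1 x h1

theorem tripledFiveCycle_degree (x : Fin 5) : tripledFiveCycle.degree x = 6 := by
  have h1 : tripledFiveCycle.loopSet x = ∅ :=
    Set.eq_empty_of_forall_notMem fun f hf => tripledFiveCycle_loopless.not_isLoopAt f x hf
  have h2 : tripledFiveCycle.incidenceSet x =
      (({e | ∃ y, s(x, y) = s(e.1, e.1 + 1)} : Finset (Fin 5 × Fin 3)) : Set (Fin 5 × Fin 3)) := by
    ext e
    simp only [mem_incidenceSet, coe_filter, mem_univ, true_and]
    rfl
  have h3 : ∀ x : Fin 5, #{e : Fin 5 × Fin 3 | ∃ y, s(x, y) = s(e.1, e.1 + 1)} = 6 := by decide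
  rw [degree, h1, h2, Set.encard_empty, add_zero, Set.encard_coe_eq_coe_finsetCard, h3]
  rfl

theorem tripledFiveCycle_minDegree : tripledFiveCycle.minDegree = 6 := by
  refine le_antisymm ?_ (le_iInf₂ fun x _ => (tripledFiveCycle_degree x).ge)
  exact (iInf₂_le 0 trivial).trans (tripledFiveCycle_degree 0).le

theorem tripledFiveCycle_adj (e f : E(tripledFiveCycle)) :
    tripledFiveCycle.lineGraph.Adj e f ↔
      e ≠ f ∧ (e.1.1 = f.1.1 ∨ f.1.1 = e.1.1 + 1 ∨ e.1.1 = f.1.1 + 1) := by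
  have h : ∀ i j : Fin 5, (∃ x, (∃ y, s(x, y) = s(i, i + 1)) ∧ ∃ y, s(x, y) = s(j, j + 1)) ↔
      (i = j ∨ j = i + 1 ∨ i = j + 1) := by decide
  exact and_congr_right fun _ => h e.1.1 f.1.1

theorem tripledFiveCycle_maxDegree_le : tripledFiveCycle.lineGraph.maxDegree ≤ 8 := by
  refine SimpleGraph.maxDegree_le_of_forall_degree_le _ _ fun e => ?_
  have h : ∀ e : Fin 5 × Fin 3,
      #{f : Fin 5 × Fin 3 | e ≠ f ∧ (e.1 = f.1 ∨ f.1 = e.1 + 1 ∨ e.1 = f.1 + 1)} ≤ 8 := by decide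
  refine le_trans ?_ (h e.1)
  rw [← SimpleGraph.card_neighborFinset_eq_degree]
  refine card_le_card_of_injOn Subtype.val (fun f hf => ?_) Subtype.val_injective.injOn
  rw [mem_coe, SimpleGraph.mem_neighborFinset, tripledFiveCycle_adj] at hf
  simpa [Subtype.ext_iff] using hf

/-- A clique uses at most two positions on the 5-cycle, with three parallel edges at each. -/
theorem tripledFiveCycle_cliqueNum_le : tripledFiveCycle.lineGraph.cliqueNum ≤ 6 := by
  obtain ⟨t, ht⟩ := tripledFiveCycle.lineGraph.exists_isNClique_cliqueNum
  rw [← ht.card_eq]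
  have h2 : ∀ S : Finset (Fin 5), (∀ i ∈ S, ∀ j ∈ S, i = j ∨ j = i + 1 ∨ i = j + 1) → #S ≤ 2 := by
    decide
  have h3 := h2 (t.image fun e => e.1.1) (by
    intro i hi j hj
    obtain ⟨e, he, rfl⟩ := mem_image.1 hi
    obtain ⟨f, hf, rfl⟩ := mem_image.1 hj
    by_cases hef : e = f
    · exact Or.inl (by rw [hef])
    · exact ((tripledFiveCycle_adj e f).1 (ht.isClique he hf hef)).2)
  have h4 := card_le_mul_card_image (f := fun e : E(tripledFiveCycle) => e.1.1) t 3 (by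
    intro i _
    refine (card_le_card_of_injOn (t := (univ : Finset (Fin 3))) (fun e => e.1.2)
      (fun _ _ => mem_coe.2 (mem_univ _)) ?_).trans (by simp)
    intro e he f hf hef
    have he' := (mem_filter.1 (mem_coe.1 he)).2
    have hf' := (mem_filter.1 (mem_coe.1 hf)).2
    exact Subtype.ext (Prod.ext (he'.trans hf'.symm) hef))
  omega

/-- Constant lists suffice: a color class is a matching of the 5-cycle, so it has at most two of the
fifteen edges. -/
theorem eight_le_of_isChoosable_tripledFiveCycle {k : ℕ}
    (hk : tripledFiveCycle.lineGraph.IsChoosable fun _ => k) : 8 ≤ k := by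
  obtain ⟨c, hc, hadj⟩ := hk (fun _ => range k) fun _ => card_range k
  have h2 : ∀ S : Finset (Fin 5), (∀ i ∈ S, ∀ j ∈ S, ¬ (j = i + 1 ∨ i = j + 1)) → #S ≤ 2 := by
    decide
  have h3 := card_le_mul_card_image_of_maps_to (s := (univ : Finset E(tripledFiveCycle)))
    (fun e _ => hc e) 2 fun i _ => by
      have hind : ∀ e ∈ ({e | c e = i} : Finset E(tripledFiveCycle)),
          ∀ f ∈ ({e | c e = i} : Finset E(tripledFiveCycle)),
          ¬ tripledFiveCycle.lineGraph.Adj e f := by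
        intro e he f hf hef
        exact hadj e f hef ((mem_filter.1 he).2.trans (mem_filter.1 hf).2.symm)
      rw [← card_image_of_injOn (f := fun e : E(tripledFiveCycle) => e.1.1)]
      · refine h2 _ fun i hi j hj => ?_
        obtain ⟨e, he, rfl⟩ := mem_image.1 hi
        obtain ⟨f, hf, rfl⟩ := mem_image.1 hj
        intro hnear
        refine hind e he f hf ((tripledFiveCycle_adj e f).2 ⟨?_, Or.inr hnear⟩)
        rintro rfl
        have h5 : ∀ i : Fin 5, ¬ (i = i + 1 ∨ i = i + 1) := by decide
        exact h5 _ hnear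
      · intro e he f hf hef
        by_contra hne
        exact hind e he f hf ((tripledFiveCycle_adj e f).2 ⟨hne, Or.inl hef⟩)
  have h4 : #(univ : Finset E(tripledFiveCycle)) = 15 := by
    rw [card_univ]
    exact (Fintype.card_congr (Equiv.Set.univ (Fin 5 × Fin 3))).trans (by simp)
  rw [h4, card_range] at h3
  omega

end Graph

theorem mainTheorem5 :
    (∀ {α β : Type*} (H : Graph α β) [Finite V(H)] [Fintype E(H)] [H.Loopless]
      [DecidableRel H.lineGraph.Adj], 7 ≤ H.minDegree →
      H.lineGraph.listChromaticNumber ≤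
        (max H.lineGraph.cliqueNum (H.lineGraph.maxDegree - 1) : ℕ)) ∧
    (Graph.tripledFiveCycle.Loopless ∧ Graph.tripledFiveCycle.minDegree = 6 ∧
      (max Graph.tripledFiveCycle.lineGraph.cliqueNum
          (Graph.tripledFiveCycle.lineGraph.maxDegree - 1) : ℕ) <
        Graph.tripledFiveCycle.lineGraph.listChromaticNumber) := by
  refine ⟨fun H _ _ _ _ hH => iInf₂_le (f := fun (k : ℕ) _ => (k : ℕ∞)) _
      (show _ ∈ {k : ℕ | _} from H.isChoosable_lineGraph hH),
    Graph.tripledFiveCycle_loopless, Graph.tripledFiveCycle_minDegree, ?_⟩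
  have h1 := Graph.tripledFiveCycle_cliqueNum_le
  have h2 := Graph.tripledFiveCycle_maxDegree_le
  have h3 : (8 : ℕ∞) ≤ Graph.tripledFiveCycle.lineGraph.listChromaticNumber :=
    le_iInf₂ fun k hk => by exact_mod_cast Graph.eight_le_of_isChoosable_tripledFiveCycle hk
  refine lt_of_lt_of_le ?_ h3
  have h4 : max Graph.tripledFiveCycle.lineGraph.cliqueNum
      (Graph.tripledFiveCycle.lineGraph.maxDegree - 1) < 8 := by omega
  exact_mod_cast h4
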